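/- A directed graph $E$ consists of a set $E^0$ of vertices, a set $E^1$ of edges and maps $s,r:E^1\to E^0$. It is row-finite if every vertex emits only finitely many edges, it has no sinks if every vertex emits at least one edge, and it has no multiple edges if an edge is determined by its source and range. Its vertex matrix $B_E$ is the $E^0\times E^0$ matrix whose entry $B_E(v,w)$ is the number of edges from $v$ to $w$. For a $0$-$1$ matrix $B$ with rows and columns indexed by a (possibly infinite) set $V$, write $B_p$ for its $p$-th row and $\varepsilon_k$ for the row with a single $1$, in position $k$. Suppose that $B_p\neq 0$ and $B_p=\varepsilon_{k_1}+\dots+\varepsilon_{k_a}+B_{m_1}+\dots+B_{m_b}$, where $k_1,\dots,k_a,m_1,\dots,m_b$ are distinct, $p\notin\{m_1,\dots,m_b\}$ and every $B_{m_i}\neq 0$. The matrix $C$ obtained from $B$ by replacing row $p$ by $\varepsilon_{k_1}+\dots+\varepsilon_{k_a}+\varepsilon_{m_1}+\dots+\varepsilon_{m_b}$ is called a primitive transfer of $B$. Two $0$-$1$ matrices $B,C$ indexed by $V$ are primitively equivalent if there are matrices $D_1=B,D_2,\dots,D_q=C$ such that for each $i<q$ either $D_i$ is a primitive transfer of $D_{i+1}$,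 or $D_{i+1}$ is a primitive transfer of $D_i$, or $D_i=PD_{i+1}P^{-1}$ for a permutation matrix $P$. Two graphs without multiple edges are primitively equivalent if, for some bijection identifying their vertex sets, their vertex matrices are primitively equivalent. For a graph $E$ let $E^\infty$ be the set of infinite paths $x=x_1x_2\cdots$ ($x_i\in E^1$, $r(x_i)=s(x_{i+1})$). The path groupoid is $\mathcal G_E=\{(x,k,y)\in E^\infty\times\mathbb Z\times E^\infty : x_i=y_{i-k}\text{ for all large } i\}$ with $(x,k,y)(y,l,z)=(x,k+l,z)$ and $(x,k,y)^{-1}=(y,-k,x)$, and with the topology generated by the sets $Z(\alpha,\beta)=\{(\alpha x,|\alpha|-|\beta|,\beta x) : x\in E^\infty,\ s(x)=r(\alpha)\}$, where $\alpha,\beta$ are finite paths (possibly of length $0$) with $r(\alpha)=r(\beta)$. For a row-finite graph $E$, $C^*(E)$ is the universal $C^*$-algebra generated by a Cuntz-Krieger $E$-family, that is, mutually orthogonal projections $P_v$ ($v\in E^0$) and partial isometries $S_e$ ($e\in E^1$) with $S_e^*S_e=P_{r(e)}$ for all $e$ and $P_v=\sum_{s(e)=v}S_eS_e^*$ for every $v$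 that emits an edge. Corollary. Let $E$ and $F$ be directed graphs without multiple edges, where $E$ is row-finite and has no sinks. If $F$ is primitively equivalent to $E$, then $\mathcal G_E\cong\mathcal G_F$ as topological groupoids (there is a groupoid isomorphism that is a homeomorphism), and hence $C^*(E)\cong C^*(F)$ as $C^*$-algebras (by a $*$-isomorphism). -/

import Mathlib

open CategoryTheory
open scoped ENNReal

universe u v

/-- A directed graph: vertices, edges, and the source and range of each edge. -/
structure DirectedGraph where
  Vertex : Type u
  Edge : Type u
  src : Edge → Vertex
  rng : Edge → Vertex

namespace DirectedGraph

section Basic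

variable (E : DirectedGraph.{u})

/-- Every vertex emits only finitely many edges. -/
def RowFinite : Prop := ∀ v : E.Vertex, {e : E.Edge | E.src e = v}.Finite

/-- Every vertex emits at least one edge. -/
def NoSinks : Prop := ∀ v : E.Vertex, ∃ e : E.Edge, E.src e = v

/-- There is at most one edge with given source and range. -/
def NoMultipleEdges : Prop :=
  ∀ e f : E.Edge, E.src e = E.src f → E.rng e = E.rng f → e = f

/-- The vertex matrix: the entry at `(v, w)` is the number of edges from `v` to `w`
(used only for graphs in which these numbers are finite). -/
noncomputable def vertexMatrix : Matrix E.Vertex E.Vertex ℕ :=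
  fun v w => {e : E.Edge | E.src e = v ∧ E.rng e = w}.ncard

end Basic

/-! ### Primitive equivalence -/

section Primitive

variable {V : Type v}

/-- All entries of the matrix are `0` or `1`. -/
def IsZeroOne (B : Matrix V V ℕ) : Prop := ∀ i j, B i j = 0 ∨ B i j = 1

open Classical in
/-- `C` is a primitive transfer of the 0-1 matrix `B` at `p`: the row `B p` is nonzero and is
the sum of the unit rows at `k ∈ K` and the (nonzero) rows `B m`, `m ∈ M`, where the indices in `K`
and `M` are all distinct and `p ∉ M`; and `C` is `B` with the `p`-th row replaced by the
indicator of `K ∪ M`. -/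
def IsPrimitiveTransferAt (B C : Matrix V V ℕ) (p : V) : Prop :=
  IsZeroOne B ∧ B p ≠ 0 ∧
    ∃ K M : Finset V, Disjoint K M ∧ p ∉ M ∧ (∀ m ∈ M, B m ≠ 0) ∧
      (∀ j, B p j = (∑ k ∈ K, if j = k then 1 else 0) + (∑ m ∈ M, B m j)) ∧
      ∀ i j, C i j = if i = p then (if j ∈ K ∨ j ∈ M then 1 else 0) else B i j

/-- `C` is a primitive transfer of `B` (at some index). -/
def IsPrimitiveTransfer (B C : Matrix V V ℕ) : Prop := ∃ p, IsPrimitiveTransferAt B C p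

/-- `B = P C P⁻¹` for some permutation matrix `P`. -/
def IsPermutationOf (B C : Matrix V V ℕ) : Prop :=
  ∃ σ : Equiv.Perm V, ∀ i j, B i j = C (σ i) (σ j)

/-- One step in a chain defining primitive equivalence. -/
def PrimitiveStep (B C : Matrix V V ℕ) : Prop :=
  IsPrimitiveTransfer C B ∨ IsPrimitiveTransfer B C ∨ IsPermutationOf B C

/-- Primitive equivalence of 0-1 matrices with the same index set: they are joined by a finite
chain of primitive steps. -/
def MatrixPrimitivelyEquivalent (B C : Matrix V V ℕ) : Prop :=
  IsZeroOne B ∧ IsZeroOne C ∧ Relation.ReflTransGen PrimitiveStep B C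

/-- Two graphs are primitively equivalent if their vertex matrices are, once the vertex sets
are identified by some bijection (as matrices that are permutations of each other are
primitively equivalent, the choice of the bijection does not matter). -/
def PrimitivelyEquivalent (E F : DirectedGraph.{u}) : Prop :=
  ∃ σ : E.Vertex ≃ F.Vertex,
    MatrixPrimitivelyEquivalent E.vertexMatrix (F.vertexMatrix.submatrix σ σ)

end Primitive

/-! ### The path groupoid -/

section Paths

variable (E : DirectedGraph.{u})

/-- An infinite path: a sequence of consecutive edges. -/
@[ext]
structure InfPath where
  edge : ℕ → E.Edge
  consecutive : ∀ i, E.rng (edge i) = E.src (edge (i + 1))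

/-- The arrows `v ⟶ w` are the edges from `v` to `w`. Accordingly `Quiver.Path v w` is the type of
finite paths from `v` to `w`, including those of length zero. -/
instance : Quiver E.Vertex where
  Hom v w := {e : E.Edge // E.src e = v ∧ E.rng e = w}

variable {E}

namespace InfPath

/-- The source of an infinite path. -/
def source (x : E.InfPath) : E.Vertex := E.src (x.edge 0)

/-- The infinite path `e x`, for an edge `e` whose range is the source of `x`. -/
def cons (e : E.Edge) (x : E.InfPath) (h : E.rng e = x.source) : E.InfPath where
  edge
    | 0 => e
    | i + 1 => x.edge i
  consecutive
    | 0 => h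
    | i + 1 => x.consecutive i

/-- The infinite path `α x`, for a finite path `α` whose range is the source of `x`. -/
def prepend {v : E.Vertex} :
    {w : E.Vertex} → (α : Quiver.Path v w) → (x : E.InfPath) → x.source = w → E.InfPath
  | _, .nil, x, _ => x
  | _, .cons α e, x, h => prepend α (x.cons e.1 (e.2.2.trans h.symm)) e.2.1

/-- `x ∼ₖ y`: `x i = y (i - k)` for all large `i`. -/
def TailEquiv (k : ℤ) (x y : E.InfPath) : Prop :=
  ∃ N : ℕ, ∀ i j : ℕ, N ≤ i → (i : ℤ) - k = j → x.edge i = y.edge j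

/-- The morphisms from `x` to `y` in the path groupoid: the triples `(x, k, y)` with `x ∼ₖ y`. -/
@[ext]
structure Hom (x y : E.InfPath) where
  lag : ℤ
  tailEquiv : TailEquiv lag x y

theorem TailEquiv.refl (x : E.InfPath) : TailEquiv 0 x x :=
  ⟨0, fun i j _ h => by rw [show i = j by omega]⟩

theorem TailEquiv.symm {k : ℤ} {x y : E.InfPath} (h : TailEquiv k x y) : TailEquiv (-k) y x := by
  obtain ⟨N, hN⟩ := h
  exact ⟨N + k.natAbs, fun i j hi hij => (hN j i (by omega) (by omega)).symm⟩

theorem TailEquiv.trans {k l : ℤ} {x y z : E.InfPath} (h : TailEquiv k x y)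
    (h' : TailEquiv l y z) : TailEquiv (k + l) x z := by
  obtain ⟨N, hN⟩ := h
  obtain ⟨N', hN'⟩ := h'
  refine ⟨N + N' + k.natAbs, fun i j hi hij => ?_⟩
  exact (hN i (i - k).toNat (by omega) (by omega)).trans (hN' _ j (by omega) (by omega))

/-- The path groupoid of `E`: its unit space is the set of infinite paths, its arrows are the
triples `(x, k, y)` with `x ∼ₖ y`, and `(x, k, y) (y, l, z) = (x, k + l, z)`,
`(x, k, y)⁻¹ = (y, -k, x)`. -/
instance pathGroupoid : Groupoid E.InfPath where
  Hom := Hom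
  id x := ⟨0, .refl x⟩
  comp f g := ⟨f.lag + g.lag, f.tailEquiv.trans g.tailEquiv⟩
  inv f := ⟨-f.lag, f.tailEquiv.symm⟩
  id_comp f := Hom.ext (zero_add f.lag)
  comp_id f := Hom.ext (add_zero f.lag)
  assoc f g h := Hom.ext (add_assoc f.lag g.lag h.lag)
  inv_comp f := Hom.ext (neg_add_cancel f.lag)
  comp_inv f := Hom.ext (add_neg_cancel f.lag)

end InfPath

/-- The set `Z(α, β)` of all arrows `(α x, |α| - |β|, β x)` of the path groupoid, for finite
paths `α` and `β` with the same range. -/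
def cylinder {v v' w : E.Vertex} (α : Quiver.Path v w) (β : Quiver.Path v' w) :
    Set (Arrow E.InfPath) :=
  {g | ∃ (x : E.InfPath) (h : x.source = w),
    g.left = x.prepend α h ∧ g.right = x.prepend β h ∧
      InfPath.Hom.lag g.hom = (α.length : ℤ) - β.length}

/-- The topology of the path groupoid (on its set of arrows), generated by the sets `Z(α, β)`. -/
instance : TopologicalSpace (Arrow E.InfPath) :=
  .generateFrom {U | ∃ (v v' w : E.Vertex) (α : Quiver.Path v w) (β : Quiver.Path v' w),
    U = cylinder α β}

end Paths

/-- Two groupoids whose sets of arrows carry topologies are isomorphic: there is a homomorphism of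
groupoids (a functor) which is a homeomorphism between the sets of arrows (and hence bijective on
units and on arrows). -/
def TopologicalGroupoidIso (G H : Type*) [Groupoid G] [Groupoid H]
    [TopologicalSpace (Arrow G)] [TopologicalSpace (Arrow H)] : Prop :=
  ∃ φ : G ⥤ H, IsHomeomorph (φ.mapArrow.obj : Arrow G → Arrow H)

/-! ### The graph algebra -/

/-- A Cuntz-Krieger `E`-family in a C⋆-algebra `A`, for a row-finite graph `E`. -/
structure CKFamily (E : DirectedGraph.{u}) (A : Type v) [NonUnitalCStarAlgebra A] where
  P : E.Vertex → A
  S : E.Edge → A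
  isStarProjection : ∀ v, IsStarProjection (P v)
  orthogonal : ∀ v w, v ≠ w → P v * P w = 0
  partialIsometry : ∀ e, S e * star (S e) * S e = S e
  star_mul_self : ∀ e, star (S e) * S e = P (E.rng e)
  sum_eq : ∀ (v : E.Vertex) (h : {e : E.Edge | E.src e = v}.Finite),
    (∃ e, E.src e = v) → P v = ∑ e ∈ h.toFinset, S e * star (S e)

/-- A Cuntz-Krieger `E`-family together with the C⋆-algebra in which it lives. -/
structure CKRep (E : DirectedGraph.{u}) : Type (u + 1) where
  Carrier : Type u
  [cstar : NonUnitalCStarAlgebra Carrier]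
  family : CKFamily E Carrier

attribute [instance] CKRep.cstar

section Algebra

theorem CKFamily.norm_P_le {E : DirectedGraph.{u}} {A : Type v} [NonUnitalCStarAlgebra A]
    (t : CKFamily E A) (v : E.Vertex) : ‖t.P v‖ ≤ 1 := (t.isStarProjection v).norm_le

theorem CKFamily.norm_S_le {E : DirectedGraph.{u}} {A : Type v} [NonUnitalCStarAlgebra A]
    (t : CKFamily E A) (e : E.Edge) : ‖t.S e‖ ≤ 1 := by
  have h : ‖t.S e‖ * ‖t.S e‖ ≤ 1 := by
    rw [← CStarRing.norm_star_mul_self, t.star_mul_self]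
    exact t.norm_P_le _
  nlinarith [norm_nonneg (t.S e)]

variable (E : DirectedGraph.{u})

/-- The C⋆-algebra of all bounded families indexed by the Cuntz-Krieger `E`-families. -/
abbrev CKProduct : Type (u + 1) := lp (fun π : CKRep E => π.Carrier) ∞

variable {E} in
/-- The vertex projection in the product. -/
noncomputable def prodP (v : E.Vertex) : CKProduct E :=
  ⟨fun π => π.family.P v,
    memℓp_infty ⟨1, by rintro _ ⟨π, rfl⟩; exact π.family.norm_P_le v⟩⟩

variable {E} in
/-- The partial isometry of an edge in the product. -/
noncomputable def prodS (e : E.Edge) : CKProduct E :=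
  ⟨fun π => π.family.S e,
    memℓp_infty ⟨1, by rintro _ ⟨π, rfl⟩; exact π.family.norm_S_le e⟩⟩

/-- The closed ⋆-subalgebra of the product generated by the projections and partial isometries. -/
noncomputable def graphSubalgebra : NonUnitalStarSubalgebra ℂ (CKProduct E) :=
  (NonUnitalStarAlgebra.adjoin ℂ
    (Set.range (prodP (E := E)) ∪ Set.range (prodS (E := E)))).topologicalClosure

/-- The graph algebra `C⋆(E)`: the universal C⋆-algebra generated by a Cuntz-Krieger `E`-family. -/
abbrev GraphCStarAlgebra : Type (u + 1) := graphSubalgebra E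

instance isClosed_graphSubalgebra : IsClosed (graphSubalgebra E : Set (CKProduct E)) :=
  NonUnitalStarSubalgebra.isClosed_topologicalClosure _

noncomputable instance : NonUnitalCStarAlgebra (GraphCStarAlgebra E) :=
  NonUnitalStarSubalgebra.nonUnitalCStarAlgebra (graphSubalgebra E)

end Algebra

/-! ### The universal property of the graph algebra -/

section Universal

variable {E : DirectedGraph.{u}}

/-- The canonical Cuntz-Krieger family in the graph algebra. -/
noncomputable def universalFamily (E : DirectedGraph.{u}) : CKFamily E (GraphCStarAlgebra E) where
  P v := ⟨prodP v, NonUnitalStarSubalgebra.le_topologicalClosure _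
    (NonUnitalStarAlgebra.subset_adjoin ℂ _ (Or.inl ⟨v, rfl⟩))⟩
  S e := ⟨prodS e, NonUnitalStarSubalgebra.le_topologicalClosure _
    (NonUnitalStarAlgebra.subset_adjoin ℂ _ (Or.inr ⟨e, rfl⟩))⟩
  isStarProjection v :=
    ⟨Subtype.ext (lp.ext (funext fun π => (π.family.isStarProjection v).isIdempotentElem)),
      Subtype.ext (lp.ext (funext fun π => (π.family.isStarProjection v).isSelfAdjoint))⟩
  orthogonal v w h := Subtype.ext (lp.ext (funext fun π => π.family.orthogonal v w h))
  partialIsometry e := Subtype.ext (lp.ext (funext fun π => π.family.partialIsometry e))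
  star_mul_self e := Subtype.ext (lp.ext (funext fun π => π.family.star_mul_self e))
  sum_eq v h hv := by
    refine Subtype.ext (lp.ext (funext fun π => ?_))
    rw [AddSubmonoidClass.coe_finsetSum, lp.coeFn_sum, Finset.sum_apply]
    exact π.family.sum_eq v h hv

/-- Evaluation of a bounded family at one Cuntz-Krieger family. -/
noncomputable def evalHom (π : CKRep E) : GraphCStarAlgebra E →⋆ₙₐ[ℂ] π.Carrier where
  toFun a := (a : CKProduct E) π
  map_smul' _ _ := rfl
  map_zero' := rfl
  map_add' _ _ := rfl
  map_mul' _ _ := rfl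
  map_star' _ := rfl

theorem hom_eq_of_eq_on_generators {A : Type v} [NonUnitalCStarAlgebra A]
    (φ ψ : GraphCStarAlgebra E →⋆ₙₐ[ℂ] A)
    (hP : ∀ v, φ ((universalFamily E).P v) = ψ ((universalFamily E).P v))
    (hS : ∀ e, φ ((universalFamily E).S e) = ψ ((universalFamily E).S e)) : φ = ψ := by
  have hcl : IsClosed {a : GraphCStarAlgebra E | φ a = ψ a} :=
    isClosed_eq
      (AddMonoidHomClass.continuous_of_bound φ 1
        (by simpa only [one_mul] using NonUnitalStarAlgHom.norm_apply_le φ))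
      (AddMonoidHomClass.continuous_of_bound ψ 1
        (by simpa only [one_mul] using NonUnitalStarAlgHom.norm_apply_le ψ))
  obtain ⟨C, hC, hCeq⟩ := isClosed_induced_iff.1 hcl
  have key : ∀ a (ha : a ∈ NonUnitalStarAlgebra.adjoin ℂ
      (Set.range (prodP (E := E)) ∪ Set.range (prodS (E := E)))),
      φ ⟨a, NonUnitalStarSubalgebra.le_topologicalClosure _ ha⟩ =
        ψ ⟨a, NonUnitalStarSubalgebra.le_topologicalClosure _ ha⟩ := by
    intro a ha
    induction ha using NonUnitalStarAlgebra.adjoin_induction with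
    | mem x hx =>
      rcases hx with ⟨v, rfl⟩ | ⟨e, rfl⟩
      · exact hP v
      · exact hS e
    | zero => exact (map_zero φ).trans (map_zero ψ).symm
    | add x y hx hy h1 h2 =>
      exact (map_add φ ⟨x, _⟩ ⟨y, _⟩).trans
        ((congrArg₂ (· + ·) h1 h2).trans (map_add ψ ⟨x, _⟩ ⟨y, _⟩).symm)
    | mul x y hx hy h1 h2 =>
      exact (map_mul φ ⟨x, _⟩ ⟨y, _⟩).trans
        ((congrArg₂ (· * ·) h1 h2).trans (map_mul ψ ⟨x, _⟩ ⟨y, _⟩).symm)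
    | smul r x hx h1 =>
      exact (map_smul φ r ⟨x, _⟩).trans
        ((congrArg (r • ·) h1).trans (map_smul ψ r ⟨x, _⟩).symm)
    | star x hx h1 =>
      exact (map_star φ ⟨x, _⟩).trans ((congrArg star h1).trans (map_star ψ ⟨x, _⟩).symm)
  refine NonUnitalStarAlgHom.ext fun a => ?_
  have : (a : CKProduct E) ∈ C := by
    refine closure_minimal (fun b hb => ?_) hC a.2
    have hb' := key b hb
    have : (⟨b, NonUnitalStarSubalgebra.le_topologicalClosure _ hb⟩ : GraphCStarAlgebra E) ∈
      Subtype.val ⁻¹' C := by rw [hCeq]; exact hb'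
    exact this
  have h2 : a ∈ Subtype.val ⁻¹' C := this
  rw [hCeq] at h2
  exact h2

/-- A small C⋆-algebra is isomorphic to one in the smaller universe. -/
theorem exists_equiv_of_small (B : Type v) [NonUnitalCStarAlgebra B] [Small.{u} B] :
    ∃ (A : Type u) (_ : NonUnitalCStarAlgebra A), Nonempty (A ≃⋆ₐ[ℂ] B) := by
  let e : Shrink.{u} B ≃ B := (equivShrink B).symm
  let r : NonUnitalRing (Shrink.{u} B) := e.nonUnitalRing
  let m : Module ℂ (Shrink.{u} B) := e.module ℂ
  let f : Shrink.{u} B ≃ₗ[ℂ] B := e.linearEquiv ℂ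
  let g : Shrink.{u} B ≃+* B := e.ringEquiv
  let n : NonUnitalNormedRing (Shrink.{u} B) :=
    NonUnitalNormedRing.induced (Shrink.{u} B) B g g.injective
  let st : StarRing (Shrink.{u} B) :=
    { star := fun x => g.symm (star (g x))
      star_involutive := fun x => by simp
      star_mul := fun x y => by simp
      star_add := fun x y => by simp }
  have hn : ∀ x : Shrink.{u} B, ‖x‖ = ‖g x‖ := fun _ => rfl
  have hs : ∀ x : Shrink.{u} B, g (star x) = star (g x) := fun x => g.apply_symm_apply _
  have hc : ∀ (c : ℂ) (x : Shrink.{u} B), g (c • x) = c • g x := fun c x => f.map_smul c x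
  have hiso : Isometry g := AddMonoidHomClass.isometry_of_norm g fun _ => rfl
  let h : NonUnitalCStarAlgebra (Shrink.{u} B) :=
    { n, st with
      toCompleteSpace := by
        have hi : IsUniformInducing g := hiso.isUniformInducing
        refine (completeSpace_iff_isComplete_range hi).2 ?_
        rw [g.surjective.range_eq]
        exact isComplete_univ
      norm_mul_self_le := fun x => by
        rw [hn, hn, map_mul, hs, CStarRing.norm_star_mul_self]
      smul := m.smul
      one_smul := m.one_smul
      mul_smul := m.mul_smul
      smul_zero := m.smul_zero
      smul_add := m.smul_add
      add_smul := m.add_smul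
      zero_smul := m.zero_smul
      norm_smul_le := fun c x => by rw [hn, hn, hc]; exact norm_smul_le c (g x)
      smul_assoc := fun c x y => g.injective (by
        rw [smul_eq_mul, smul_eq_mul, hc, map_mul, map_mul, hc, smul_mul_assoc])
      smul_comm := fun c x y => g.injective (by
        rw [smul_eq_mul, smul_eq_mul, hc, map_mul, map_mul, hc, mul_smul_comm])
      star_smul := fun c x => g.injective (by rw [hs, hc, hc, hs, star_smul]) }
  refine ⟨Shrink.{u} B, h, ⟨?_⟩⟩
  exact { g with
    map_star' := hs
    map_smul' := hc }

/-- Formal non-unital ⋆-polynomials. -/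
inductive StarTerm (X : Type u) : Type u
  | zero : StarTerm X
  | of (x : X) : StarTerm X
  | add (s t : StarTerm X) : StarTerm X
  | mul (s t : StarTerm X) : StarTerm X
  | smul (c : ℂ) (t : StarTerm X) : StarTerm X
  | star (t : StarTerm X) : StarTerm X

/-- The value of a formal ⋆-polynomial. -/
noncomputable def StarTerm.eval {X : Type u} {A : Type v} [NonUnitalCStarAlgebra A] (f : X → A) :
    StarTerm X → A
  | zero => 0
  | of x => f x
  | add s t => s.eval f + t.eval f
  | mul s t => s.eval f * t.eval f
  | smul c t => c • t.eval f
  | star t => Star.star (t.eval f)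

/-- A C⋆-algebra generated by a set that is small in some universe is itself small. -/
theorem small_closure_adjoin {A : Type v} [NonUnitalCStarAlgebra A] (s : Set A) [Small.{u} s] :
    Small.{u} (NonUnitalStarAlgebra.adjoin ℂ s).topologicalClosure := by
  let f : Shrink.{u} s → A := fun x => ((equivShrink s).symm x : A)
  have hsub : ((NonUnitalStarAlgebra.adjoin ℂ s : NonUnitalStarSubalgebra ℂ A) : Set A) ⊆
      Set.range (StarTerm.eval f) := by
    intro a ha
    induction ha using NonUnitalStarAlgebra.adjoin_induction with
    | mem x hx => exact ⟨.of (equivShrink s ⟨x, hx⟩), by simp [StarTerm.eval, f]⟩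
    | zero => exact ⟨.zero, rfl⟩
    | add x y hx hy h1 h2 =>
      obtain ⟨p, rfl⟩ := h1
      obtain ⟨q, rfl⟩ := h2
      exact ⟨.add p q, rfl⟩
    | mul x y hx hy h1 h2 =>
      obtain ⟨p, rfl⟩ := h1
      obtain ⟨q, rfl⟩ := h2
      exact ⟨.mul p q, rfl⟩
    | smul r x hx h1 =>
      obtain ⟨p, rfl⟩ := h1
      exact ⟨.smul r p, rfl⟩
    | star x hx h1 =>
      obtain ⟨p, rfl⟩ := h1
      exact ⟨.star p, rfl⟩
  have hsm : Small.{u} (NonUnitalStarAlgebra.adjoin ℂ s : Set A) := small_subset hsub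
  have hseq : ∀ a : (NonUnitalStarAlgebra.adjoin ℂ s).topologicalClosure,
      ∃ x : ℕ → (NonUnitalStarAlgebra.adjoin ℂ s : Set A),
        Filter.Tendsto (fun n => (x n : A)) Filter.atTop (nhds (a : A)) := by
    intro a
    obtain ⟨x, hx, hlim⟩ := mem_closure_iff_seq_limit.1 a.2
    exact ⟨fun n => ⟨x n, hx n⟩, hlim⟩
  choose x hx using hseq
  refine small_of_injective (f := x) fun a b hab => Subtype.ext ?_
  exact tendsto_nhds_unique (hx a) (hab ▸ hx b)

/-- The universal property: every Cuntz-Krieger `E`-family in a C⋆-algebra (in any universe) is the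
image of the canonical one under a unique ⋆-homomorphism. -/
theorem existsUnique_lift {A : Type v} [NonUnitalCStarAlgebra A] (t : CKFamily E A) :
    ∃! φ : GraphCStarAlgebra E →⋆ₙₐ[ℂ] A,
      (∀ v, φ ((universalFamily E).P v) = t.P v) ∧ ∀ e, φ ((universalFamily E).S e) = t.S e := by
  let s : Set A := Set.range t.P ∪ Set.range t.S
  have hsmall : Small.{u} s := small_union _ _
  let B : NonUnitalStarSubalgebra ℂ A := (NonUnitalStarAlgebra.adjoin ℂ s).topologicalClosure
  have hB : IsClosed (B : Set A) := NonUnitalStarSubalgebra.isClosed_topologicalClosure _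
  have hBs : Small.{u} B := small_closure_adjoin s
  obtain ⟨A', hA', ⟨ε⟩⟩ := exists_equiv_of_small.{u} B
  have hP : ∀ v, t.P v ∈ B := fun v => NonUnitalStarSubalgebra.le_topologicalClosure _
    (NonUnitalStarAlgebra.subset_adjoin ℂ _ (Or.inl ⟨v, rfl⟩))
  have hS : ∀ e, t.S e ∈ B := fun e => NonUnitalStarSubalgebra.le_topologicalClosure _
    (NonUnitalStarAlgebra.subset_adjoin ℂ _ (Or.inr ⟨e, rfl⟩))
  let ι : A' →⋆ₙₐ[ℂ] A :=
    { toFun := fun a => (ε a : A)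
      map_smul' := fun c a => by simp
      map_zero' := by simp
      map_add' := fun a b => by simp
      map_mul' := fun a b => by simp
      map_star' := fun a => by simp [map_star] }
  have hι : Function.Injective ι := Subtype.val_injective.comp ε.injective
  choose P hP' using fun v => show ∃ a, ι a = t.P v from
    ⟨ε.symm ⟨t.P v, hP v⟩, by simp [ι]⟩
  choose S hS' using fun e => show ∃ a, ι a = t.S e from
    ⟨ε.symm ⟨t.S e, hS e⟩, by simp [ι]⟩
  let π : CKRep E :=
    { Carrier := A'
      family :=
        { P := P
          S := S
          isStarProjection := fun v =>
            ⟨hι (by rw [map_mul, hP']; exact (t.isStarProjection v).isIdempotentElem),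
              hι (by rw [map_star, hP']; exact (t.isStarProjection v).isSelfAdjoint)⟩
          orthogonal := fun v w h => hι (by
            rw [map_mul, hP', hP', map_zero]; exact t.orthogonal v w h)
          partialIsometry := fun e => hι (by
            rw [map_mul, map_mul, map_star, hS']; exact t.partialIsometry e)
          star_mul_self := fun e => hι (by
            rw [map_mul, map_star, hS', hP']; exact t.star_mul_self e)
          sum_eq := fun v h hv => hι (by
            rw [map_sum, hP', t.sum_eq v h hv]
            exact Finset.sum_congr rfl fun e _ => by rw [map_mul, map_star, hS']) } }
  have h1 : ∀ v, (ι.comp (evalHom π)) ((universalFamily E).P v) = t.P v := fun v => hP' v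
  have h2 : ∀ e, (ι.comp (evalHom π)) ((universalFamily E).S e) = t.S e := fun e => hS' e
  refine ⟨ι.comp (evalHom π), ⟨h1, h2⟩, fun ψ hψ => ?_⟩
  exact hom_eq_of_eq_on_generators _ _ (fun v => (hψ.1 v).trans (h1 v).symm)
    fun e => (hψ.2 e).trans (h2 e).symm

end Universal

end DirectedGraph

/-! A primitive transfer from `B` to `C` amounts to a recoding of paths. Let `E` and `F` be the
graphs of `B` and `C`. As all entries are 0 or 1, each edge `p → j` of `E` either has `j ∈ K`, and
is then also an edge of `F`, or has `B m j = 1` for exactly one `m ∈ M`, and is then replaced by the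
path `p → m → j` of `F`. All other edges stay. The edges `p → m` with `m ∈ M` are the split edges;
no two of them are consecutive, because `p ∉ M`. `EdgeRecoding` keeps just these properties.

Groupoids: an infinite path of `F` is cut into blocks of length one or two in exactly one way, since
the first edge of a block shows its length. So replacing edges by blocks is a bijection of infinite
paths. If `x` and `y` agree after removal of `a` and `b` edges, their images agree after removal of
`R.pos a x` and `R.pos b y` edges, and the difference of these numbers is the new lag. Conversely,
equal remainders in `F` may begin inside a block, but one common edge tells how far away the next
boundary is, so both paths reach boundaries after equally many steps (`exists_shift_eq`). This gives
bijectivity on arrows and, through `arrowMap_mem_arrowNhd_iff`, the homeomorphism.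

Algebras: the isomorphism comes from the universal property and not from the groupoids. An
`F`-family yields an `E`-family in which `S e` is the product along the block of `e`. Conversely,
for a split edge `d`, the relation `S d = S d * P (rng d) = ∑ S d * S f * star (S f)` forces `S d`
to be the sum of `S e * star (S (last e))` over the edges `e` whose blocks start with `d`.

For a chain of steps, `RegularEquivalent` carries row-finiteness and absence of sinks along with the
isomorphisms and is an equivalence relation, so the direction of a transfer does not matter. -/

namespace DirectedGraph

/-! ### Shifts of paths and neighbourhoods of arrows -/

section Shift

variable {E : DirectedGraph.{u}}

namespace InfPath

/-- The infinite path with its first `n` edges removed. -/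
def shift (n : ℕ) (x : E.InfPath) : E.InfPath where
  edge i := x.edge (n + i)
  consecutive i := x.consecutive (n + i)

@[simp]
theorem shift_edge (n i : ℕ) (x : E.InfPath) : (x.shift n).edge i = x.edge (n + i) := rfl

theorem shift_shift (m n : ℕ) (x : E.InfPath) : (x.shift n).shift m = x.shift (n + m) :=
  InfPath.ext (funext fun i => by simp [add_assoc])

@[simp]
theorem shift_zero (x : E.InfPath) : x.shift 0 = x :=
  InfPath.ext (funext fun i => by simp)

theorem shift_add_eq {x y : E.InfPath} {a b : ℕ} (h : x.shift a = y.shift b) (n : ℕ) :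
    x.shift (a + n) = y.shift (b + n) := by
  rw [← shift_shift, ← shift_shift, h]

theorem prepend_edge_add {v w : E.Vertex} (α : Quiver.Path v w) (x : E.InfPath)
    (h : x.source = w) (i : ℕ) : (x.prepend α h).edge (α.length + i) = x.edge i := by
  induction α generalizing i x with
  | nil => simp [prepend]
  | cons α e ih =>
    rw [Quiver.Path.length_cons, show α.length + 1 + i = α.length + (i + 1) by omega]
    exact ih _ _ (i + 1)

theorem prepend_edge_of_lt {v w : E.Vertex} (α : Quiver.Path v w) (x y : E.InfPath)
    (hx : x.source = w) (hy : y.source = w) {i : ℕ} (hi : i < α.length) :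
    (x.prepend α hx).edge i = (y.prepend α hy).edge i := by
  induction α generalizing x y with
  | nil => simp at hi
  | cons α e ih =>
    rw [Quiver.Path.length_cons] at hi
    rcases Nat.lt_or_ge i α.length with h | h
    · exact ih _ _ _ _ h
    · obtain rfl : i = α.length + 0 := by omega
      exact (prepend_edge_add α _ _ 0).trans 
        (prepend_edge_add α (y.cons e.1 (e.2.2.trans hy.symm)) e.2.1 0).symm

theorem shift_prepend {v w : E.Vertex} (α : Quiver.Path v w) (x : E.InfPath)
    (h : x.source = w) : (x.prepend α h).shift α.length = x :=
  InfPath.ext (funext fun i => prepend_edge_add α x h i)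

theorem eq_prepend_shift {v w : E.Vertex} (α : Quiver.Path v w) (x y : E.InfPath)
    (hx : x.source = w) (hy : (y.shift α.length).source = w)
    (h : ∀ i < α.length, y.edge i = (x.prepend α hx).edge i) :
    y = (y.shift α.length).prepend α hy := by
  ext i
  rcases Nat.lt_or_ge i α.length with hi | hi
  · rw [h i hi]
    exact prepend_edge_of_lt α _ _ _ _ hi
  · obtain ⟨j, rfl⟩ := Nat.exists_eq_add_of_le hi
    rw [prepend_edge_add]
    rfl

theorem exists_prepend_shift (x : E.InfPath) (n : ℕ) {w : E.Vertex}
    (hw : (x.shift n).source = w) :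
    ∃ α : Quiver.Path x.source w, α.length = n ∧ (x.shift n).prepend α hw = x := by
  induction n generalizing w with
  | zero =>
    rw [shift_zero] at hw
    subst hw
    exact ⟨.nil, rfl, shift_zero x⟩
  | succ n ih =>
    obtain ⟨α, hα, hαx⟩ := ih rfl
    have hr : E.rng (x.edge n) = w := (x.consecutive n).trans hw
    let e : (x.shift n).source ⟶ w := ⟨x.edge n, rfl, hr⟩
    refine ⟨α.cons e, by rw [Quiver.Path.length_cons, hα], ?_⟩
    rw [prepend]
    refine Eq.trans ?_ hαx
    congr 1
    ext i
    cases i with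
    | zero => rfl
    | succ i =>
      change x.edge (n + 1 + i) = x.edge (n + (i + 1))
      congr 1
      omega

theorem TailEquiv.exists_shift_eq {k : ℤ} {x y : E.InfPath} (h : TailEquiv k x y) :
    ∃ a b : ℕ, k = (a : ℤ) - b ∧ x.shift a = y.shift b := by
  obtain ⟨N, hN⟩ := h
  -- Adding `|k|` keeps the first index at least `N` and makes the second one nonnegative, so
  -- `toNat` loses nothing.
  refine ⟨N + k.natAbs, (N + k.natAbs - k : ℤ).toNat, by omega, ?_⟩
  ext i
  exact hN _ _ (by omega) (by omega)

theorem TailEquiv.of_shift_eq {x y : E.InfPath} {a b : ℕ} (h : x.shift a = y.shift b) :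
    TailEquiv ((a : ℤ) - b) x y := by
  refine ⟨a, fun i j hi hij => ?_⟩
  have := congrArg (fun z => InfPath.edge z (i - a)) h
  simp only [shift_edge] at this
  rwa [show a + (i - a) = i by omega, show b + (i - a) = j by omega] at this

end InfPath

open InfPath

/-- The lag of an arrow of the path groupoid. -/
def arrowLag (g : Arrow E.InfPath) : ℤ := InfPath.Hom.lag g.hom

theorem arrow_ext {g h : Arrow E.InfPath} (hl : g.left = h.left) (hr : g.right = h.right)
    (hk : arrowLag g = arrowLag h) : g = h := by
  obtain ⟨x, y, f⟩ := g
  obtain ⟨x', y', f'⟩ := h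
  change x = x' at hl
  change y = y' at hr
  subst hl hr
  have : f = f' := InfPath.Hom.ext hk
  rw [this]

/-- The arrows `(x', a - b, y')` such that `x'` and `x` have the same initial segments of length
`a`, such that `y'` and `y` have the same initial segments of length `b`, and such that the
remainders of `x'` and `y'` are equal. -/
def arrowNhd (a b : ℕ) (x y : E.InfPath) : Set (Arrow E.InfPath) :=
  {g | (∀ i < a, g.left.edge i = x.edge i) ∧ (∀ i < b, g.right.edge i = y.edge i) ∧
    g.left.shift a = g.right.shift b ∧ (g.left.shift a).source = (x.shift a).source ∧
      arrowLag g = (a : ℤ) - b}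

theorem mem_arrowNhd_self {g : Arrow E.InfPath} {a b : ℕ} (h : g.left.shift a = g.right.shift b)
    (hk : arrowLag g = (a : ℤ) - b) : g ∈ arrowNhd a b g.left g.right :=
  ⟨fun _ _ => rfl, fun _ _ => rfl, h, rfl, hk⟩

theorem shift_eq_of_mem_cylinder {v v' w : E.Vertex} {α : Quiver.Path v w}
    {β : Quiver.Path v' w} {g : Arrow E.InfPath} (hg : g ∈ cylinder α β) :
    g.left.shift α.length = g.right.shift β.length := by
  obtain ⟨x, hx, hl, hr, -⟩ := hg
  rw [hl, hr, shift_prepend, shift_prepend]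

/-- Any member of a cylinder can serve as its centre, so finite paths disappear from the topology
and only two lengths remain. The source condition in `arrowNhd` is needed for paths of length zero,
where no edge records the vertex. -/
theorem cylinder_eq_arrowNhd {v v' w : E.Vertex} {α : Quiver.Path v w}
    {β : Quiver.Path v' w} {g : Arrow E.InfPath} (hg : g ∈ cylinder α β) :
    cylinder α β = arrowNhd α.length β.length g.left g.right := by
  obtain ⟨x, hx, hl, hr, -⟩ := hg
  rw [hl, hr]
  ext g'
  constructor
  · rintro ⟨x', hx', hl', hr', hk'⟩
    refine ⟨?_, ?_, ?_, ?_, hk'⟩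
    · intro i hi
      rw [hl']
      exact prepend_edge_of_lt α _ _ _ _ hi
    · intro i hi
      rw [hr']
      exact prepend_edge_of_lt β _ _ _ _ hi
    · rw [hl', hr', shift_prepend, shift_prepend]
    · rw [hl', shift_prepend, shift_prepend, hx, hx']
  · rintro ⟨h1, h2, h3, h4, h5⟩
    rw [shift_prepend, hx] at h4
    refine ⟨g'.left.shift α.length, h4, eq_prepend_shift α x _ hx h4 h1, ?_, h5⟩
    simp only [h3] at h4 ⊢
    exact eq_prepend_shift β x _ hx h4 h2

theorem exists_cylinder_eq {a b : ℕ} {g : Arrow E.InfPath}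
    (h : g.left.shift a = g.right.shift b) (hk : arrowLag g = (a : ℤ) - b) :
    ∃ (v v' w : E.Vertex) (α : Quiver.Path v w) (β : Quiver.Path v' w),
      arrowNhd a b g.left g.right = cylinder α β := by
  obtain ⟨α, hα, hαx⟩ := exists_prepend_shift g.left a rfl
  obtain ⟨β, hβ, hβx⟩ := exists_prepend_shift g.right b (congrArg source h.symm)
  have hg : g ∈ cylinder α β := by
    refine ⟨_, rfl, hαx.symm, ?_, by rw [hα, hβ]; exact hk⟩
    simp only [h]
    exact hβx.symm
  have := cylinder_eq_arrowNhd hg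
  rw [hα, hβ] at this
  exact ⟨_, _, _, α, β, this.symm⟩

theorem isOpen_arrow_of_forall {U : Set (Arrow E.InfPath)}
    (hU : ∀ g ∈ U, ∃ a b : ℕ, arrowLag g = (a : ℤ) - b ∧ g.left.shift a = g.right.shift b ∧
      arrowNhd a b g.left g.right ⊆ U) : IsOpen U := by
  refine isOpen_iff_forall_mem_open.2 fun g hg => ?_
  obtain ⟨a, b, hk, hs, hsub⟩ := hU g hg
  refine ⟨_, hsub, ?_, mem_arrowNhd_self hs hk⟩
  obtain ⟨v, v', w, α, β, h⟩ := exists_cylinder_eq hs hk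
  rw [h]
  exact TopologicalSpace.isOpen_generateFrom_of_mem ⟨v, v', w, α, β, rfl⟩

/-- The `n` additional edges agree on both sides because they are copied from `g`, whose remainders
after `a` and `b` are already equal. -/
theorem arrowNhd_add_subset {a b : ℕ} {g : Arrow E.InfPath}
    (h : g.left.shift a = g.right.shift b) (n : ℕ) :
    arrowNhd (a + n) (b + n) g.left g.right ⊆ arrowNhd a b g.left g.right := by
  rintro g' ⟨h1, h2, h3, h4, h5⟩
  have key : g'.left.shift a = g'.right.shift b := by
    ext i
    rcases Nat.lt_or_ge i n with hi | hi
    · rw [shift_edge, shift_edge, h1 _ (by omega), h2 _ (by omega)]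
      exact congrArg (fun z => InfPath.edge z i) h
    · obtain ⟨j, rfl⟩ := Nat.exists_eq_add_of_le hi
      have := congrArg (fun z => InfPath.edge z j) h3
      simpa only [shift_edge, add_assoc] using this
  refine ⟨fun i hi => h1 i (by omega), fun i hi => h2 i (by omega), key, ?_, ?_⟩
  -- For `n > 0` the source is read off the edge in position `a`, which is then among the prescribed
  -- ones.
  · rcases Nat.eq_zero_or_pos n with rfl | hn
    · exact h4
    · change E.src _ = E.src _
      rw [shift_edge, shift_edge, h1 _ (by omega)]
  · rw [h5]
    push_cast
    ring

end Shift

open InfPath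

/-! ### Recodings -/

/-- A recoding of the edges of `E` by edges of `F`: the vertices correspond, and every edge of `E`
is replaced either by an edge of `F` outside the set `split`, or by a path `d f` of length two with
`d` in `split`; all such edges and paths occur exactly once. Edges in `split` are never
consecutive. -/
structure EdgeRecoding (E F : DirectedGraph.{u}) where
  vertexEquiv : E.Vertex ≃ F.Vertex
  split : Set F.Edge
  fst : E.Edge → F.Edge
  lst : E.Edge → F.Edge
  src_fst : ∀ e, F.src (fst e) = vertexEquiv (E.src e)
  rng_lst : ∀ e, F.rng (lst e) = vertexEquiv (E.rng e)
  notMem_of_consecutive : ∀ d ∈ split, ∀ f, F.rng d = F.src f → f ∉ split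
  lst_eq : ∀ e, fst e ∉ split → lst e = fst e
  consecutive : ∀ e, fst e ∈ split → F.rng (fst e) = F.src (lst e)
  edge_ext : ∀ e e', fst e = fst e' → lst e = lst e' → e = e'
  exists_single : ∀ f, f ∉ split → ∃ e, fst e = f
  exists_pair : ∀ d ∈ split, ∀ f, F.rng d = F.src f → ∃ e, fst e = d ∧ lst e = f

namespace EdgeRecoding

variable {E F : DirectedGraph.{u}} (R : EdgeRecoding E F)

theorem lst_notMem (e : E.Edge) : R.lst e ∉ R.split := by
  by_cases h : R.fst e ∈ R.split
  · exact R.notMem_of_consecutive _ h _ (R.consecutive e h)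
  · rwa [R.lst_eq e h]

open Classical in
/-- The length of the block of edges starting with an edge of `F`. -/
noncomputable def blockLength (f : F.Edge) : ℕ := if f ∈ R.split then 2 else 1

theorem blockLength_of_mem {f : F.Edge} (h : f ∈ R.split) : R.blockLength f = 2 := if_pos h

theorem blockLength_of_notMem {f : F.Edge} (h : f ∉ R.split) : R.blockLength f = 1 := if_neg h

theorem blockLength_pos (f : F.Edge) : 0 < R.blockLength f := by
  unfold blockLength
  split_ifs <;> omega

open Classical in
/-- The edges of the path of `F` which is obtained by replacing the edges of a path of `E`. -/
noncomputable def pathEdge : ℕ → E.InfPath → F.Edge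
  | 0, x => R.fst (x.edge 0)
  | 1, x => if R.fst (x.edge 0) ∈ R.split then R.lst (x.edge 0) else R.fst (x.edge 1)
  | n + 2, x =>
    if R.fst (x.edge 0) ∈ R.split then pathEdge n (x.shift 1) else pathEdge (n + 1) (x.shift 1)

theorem pathEdge_zero (x : E.InfPath) : R.pathEdge 0 x = R.fst (x.edge 0) := by
  rw [pathEdge]

theorem pathEdge_one {x : E.InfPath} (h : R.fst (x.edge 0) ∈ R.split) :
    R.pathEdge 1 x = R.lst (x.edge 0) := by
  rw [pathEdge, if_pos h]

/-- The uniform recursion over blocks, used below in place of the three defining clauses. -/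
theorem pathEdge_add (x : E.InfPath) (i : ℕ) :
    R.pathEdge (R.blockLength (R.fst (x.edge 0)) + i) x = R.pathEdge i (x.shift 1) := by
  by_cases h : R.fst (x.edge 0) ∈ R.split
  · rw [R.blockLength_of_mem h, add_comm, pathEdge, if_pos h]
  · rw [R.blockLength_of_notMem h, add_comm]
    cases i with
    -- After a block of length one the index is 1, which falls under the second clause of `pathEdge`
    -- and not under the recursive one.
    | zero => rw [zero_add, pathEdge_zero, pathEdge.eq_2, if_neg h, shift_edge]
    | succ i => rw [pathEdge, if_neg h]

/-- Induction along the blocks of the path of `F` obtained from a path of `E`. -/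
theorem block_induction {motive : ℕ → E.InfPath → Prop} (zero : ∀ x, motive 0 x)
    (one : ∀ x, R.fst (x.edge 0) ∈ R.split → motive 1 x)
    (add : ∀ x i, motive i (x.shift 1) → motive (R.blockLength (R.fst (x.edge 0)) + i) x)
    (n : ℕ) (x : E.InfPath) : motive n x := by
  induction n using Nat.strong_induction_on generalizing x with
  | _ n ih =>
    rcases Nat.lt_or_ge n (R.blockLength (R.fst (x.edge 0))) with h | h
    · by_cases hs : R.fst (x.edge 0) ∈ R.split
      · rw [R.blockLength_of_mem hs] at h
        interval_cases n
        · exact zero x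
        · exact one x hs
      · rw [R.blockLength_of_notMem hs] at h
        obtain rfl : n = 0 := by omega
        exact zero x
    · obtain ⟨i, rfl⟩ := Nat.exists_eq_add_of_le h
      have := R.blockLength_pos (R.fst (x.edge 0))
      exact add x i (ih i (by omega) _)

theorem pathEdge_consecutive (n : ℕ) (x : E.InfPath) :
    F.rng (R.pathEdge n x) = F.src (R.pathEdge (n + 1) x) := by
  have key : ∀ x : E.InfPath, F.rng (R.lst (x.edge 0)) = F.src (R.pathEdge 0 (x.shift 1)) := by
    intro x
    rw [R.rng_lst, pathEdge_zero, R.src_fst, shift_edge, x.consecutive]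
  refine R.block_induction (motive := fun n x =>
    F.rng (R.pathEdge n x) = F.src (R.pathEdge (n + 1) x)) (fun x => ?_) (fun x hx => ?_)
    (fun x i h => ?_) n x
  · by_cases h : R.fst (x.edge 0) ∈ R.split
    · rw [zero_add, R.pathEdge_one h, pathEdge_zero, R.consecutive _ h]
    · rw [pathEdge_zero, ← R.lst_eq _ h, key, ← R.pathEdge_add, R.blockLength_of_notMem h]
  · rw [R.pathEdge_one hx, key, ← R.pathEdge_add, R.blockLength_of_mem hx]
  · rw [R.pathEdge_add, add_assoc, R.pathEdge_add, h]

/-- The path of `F` obtained by replacing the edges of a path of `E`. -/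
noncomputable def toPath (x : E.InfPath) : F.InfPath where
  edge i := R.pathEdge i x
  consecutive i := R.pathEdge_consecutive i x

theorem toPath_edge (x : E.InfPath) (i : ℕ) : (R.toPath x).edge i = R.pathEdge i x := rfl

theorem toPath_source (x : E.InfPath) : (R.toPath x).source = R.vertexEquiv x.source := by
  rw [source, toPath_edge, pathEdge_zero, R.src_fst]
  rfl

theorem toPath_shift (x : E.InfPath) :
    (R.toPath x).shift (R.blockLength (R.fst (x.edge 0))) = R.toPath (x.shift 1) :=
  InfPath.ext (funext fun i => R.pathEdge_add x i)

/-- The first edge of a block decides whether there is a second one, and both together determine the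
edge of `E` by `edge_ext`. -/
theorem edge_zero_eq {x y : E.InfPath}
    (h : ∀ i < R.blockLength (R.fst (x.edge 0)), (R.toPath x).edge i = (R.toPath y).edge i) :
    x.edge 0 = y.edge 0 := by
  have h0 : R.fst (x.edge 0) = R.fst (y.edge 0) := by
    simpa only [toPath_edge, pathEdge_zero] using h 0 (R.blockLength_pos _)
  refine R.edge_ext _ _ h0 ?_
  by_cases hx : R.fst (x.edge 0) ∈ R.split
  · have h1 := h 1 (by rw [R.blockLength_of_mem hx]; omega)
    rwa [toPath_edge, toPath_edge, R.pathEdge_one hx, R.pathEdge_one (h0 ▸ hx)] at h1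
  · rw [R.lst_eq _ hx, R.lst_eq _ (h0 ▸ hx), h0]

theorem toPath_edge_eq {x y : E.InfPath} (h : x.edge 0 = y.edge 0) {i : ℕ}
    (hi : i < R.blockLength (R.fst (x.edge 0))) : (R.toPath x).edge i = (R.toPath y).edge i := by
  have h0 : R.pathEdge 0 x = R.pathEdge 0 y := by rw [pathEdge_zero, pathEdge_zero, h]
  by_cases hx : R.fst (x.edge 0) ∈ R.split
  · rw [R.blockLength_of_mem hx] at hi
    interval_cases i
    · exact h0
    · rw [toPath_edge, toPath_edge, R.pathEdge_one hx, R.pathEdge_one (h ▸ hx), h]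
  · rw [R.blockLength_of_notMem hx] at hi
    obtain rfl : i = 0 := by omega
    exact h0

theorem toPath_injective : Function.Injective R.toPath := by
  intro x y h
  ext n
  induction n generalizing x y with
  | zero => exact R.edge_zero_eq fun i _ => by rw [h]
  | succ n ih =>
    have h0 : x.edge 0 = y.edge 0 := R.edge_zero_eq fun i _ => by rw [h]
    have := ih (x := x.shift 1) (y := y.shift 1) (by
      rw [← toPath_shift, ← toPath_shift, h, h0])
    simpa only [shift_edge, add_comm] using this

/-! ### Cutting a path of `F` into blocks -/

theorem exists_block (y : F.InfPath) :
    ∃ e, R.fst e = y.edge 0 ∧ (y.edge 0 ∈ R.split → R.lst e = y.edge 1) := by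
  by_cases h : y.edge 0 ∈ R.split
  · obtain ⟨e, h1, h2⟩ := R.exists_pair _ h _ (y.consecutive 0)
    exact ⟨e, h1, fun _ => h2⟩
  · obtain ⟨e, h1⟩ := R.exists_single _ h
    exact ⟨e, h1, fun h' => absurd h' h⟩

/-- The first edge of the path of `E` corresponding to a path of `F`. -/
noncomputable def block (y : F.InfPath) : E.Edge := (R.exists_block y).choose

theorem fst_block (y : F.InfPath) : R.fst (R.block y) = y.edge 0 :=
  (R.exists_block y).choose_spec.1

theorem lst_block {y : F.InfPath} (h : y.edge 0 ∈ R.split) : R.lst (R.block y) = y.edge 1 :=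
  (R.exists_block y).choose_spec.2 h

/-- The path of `F` with its first block removed. -/
noncomputable def dropBlock (y : F.InfPath) : F.InfPath := y.shift (R.blockLength (y.edge 0))

theorem rng_block (y : F.InfPath) : E.rng (R.block y) = E.src (R.block (R.dropBlock y)) := by
  apply R.vertexEquiv.injective
  rw [← R.rng_lst, ← R.src_fst, R.fst_block, dropBlock, shift_edge]
  by_cases h : y.edge 0 ∈ R.split
  · rw [R.lst_block h, R.blockLength_of_mem h]
    exact y.consecutive 1
  · rw [R.lst_eq _ (by rwa [R.fst_block]), R.fst_block, R.blockLength_of_notMem h]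
    exact y.consecutive 0

/-- The path of `E` corresponding to a path of `F`. -/
noncomputable def ofPath (y : F.InfPath) : E.InfPath where
  edge n := R.block (R.dropBlock^[n] y)
  consecutive n := by
    rw [Function.iterate_succ_apply']
    exact R.rng_block _

theorem ofPath_shift (y : F.InfPath) : (R.ofPath y).shift 1 = R.ofPath (R.dropBlock y) :=
  InfPath.ext (funext fun n => by
    rw [shift_edge, add_comm, ofPath, ofPath]
    exact congrArg R.block (Function.iterate_succ_apply _ _ _))

theorem toPath_ofPath (y : F.InfPath) : R.toPath (R.ofPath y) = y := by
  ext n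
  have h0 : ∀ y, R.fst ((R.ofPath y).edge 0) = y.edge 0 := fun y => R.fst_block y
  -- `block_induction` runs over paths of `E`, so `ofPath y` is replaced by a variable tied to `y`
  -- by an equation.
  suffices h : ∀ x, ∀ y, x = R.ofPath y → R.pathEdge n x = y.edge n from h _ y rfl
  refine R.block_induction (motive := fun n x =>
    ∀ y, x = R.ofPath y → R.pathEdge n x = y.edge n) (fun x y hx => ?_) (fun x hs y hx => ?_)
    (fun x i h y hx => ?_) n
  · rw [pathEdge_zero, hx, h0]
  · rw [R.pathEdge_one hs]
    rw [hx, h0] at hs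
    rw [hx]
    exact R.lst_block hs
  · rw [R.pathEdge_add, h (R.dropBlock y) (by rw [hx, ofPath_shift]), hx, h0]
    rfl

/-! ### Positions of block boundaries -/

/-- The position in the path of `F` of the block that replaces the edge in position `n`. -/
noncomputable def pos (n : ℕ) (x : E.InfPath) : ℕ :=
  ∑ i ∈ Finset.range n, R.blockLength (R.fst (x.edge i))

theorem pos_zero (x : E.InfPath) : R.pos 0 x = 0 := rfl

theorem pos_succ (n : ℕ) (x : E.InfPath) :
    R.pos (n + 1) x = R.pos n x + R.blockLength (R.fst (x.edge n)) := Finset.sum_range_succ _ _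

theorem pos_succ' (n : ℕ) (x : E.InfPath) :
    R.pos (n + 1) x = R.blockLength (R.fst (x.edge 0)) + R.pos n (x.shift 1) := by
  rw [pos, Finset.sum_range_succ', add_comm, pos]
  simp only [shift_edge, add_comm]

theorem pos_add (m n : ℕ) (x : E.InfPath) :
    R.pos (m + n) x = R.pos m x + R.pos n (x.shift m) := Finset.sum_range_add _ _ _

theorem pos_strictMono (x : E.InfPath) : StrictMono fun n => R.pos n x :=
  strictMono_nat_of_lt_succ fun n => by
    rw [pos_succ]
    exact Nat.lt_add_of_pos_right (R.blockLength_pos _)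

theorem toPath_shift_pos (n : ℕ) (x : E.InfPath) :
    (R.toPath x).shift (R.pos n x) = R.toPath (x.shift n) := by
  induction n with
  | zero => rw [pos_zero, shift_zero, shift_zero]
  | succ n ih =>
    rw [pos_succ, ← shift_shift, ih, ← shift_shift, ← toPath_shift]
    rfl

theorem pos_eq_of_edge_eq {n : ℕ} {x y : E.InfPath} (h : ∀ i < n, x.edge i = y.edge i) :
    R.pos n x = R.pos n y :=
  Finset.sum_congr rfl fun i hi => by rw [h i (Finset.mem_range.1 hi)]

/-- Initial segments that end at block boundaries carry the same information in `E` and in `F`; this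
is what matches the two topologies. -/
theorem forall_edge_eq_iff {n : ℕ} {x y : E.InfPath} :
    (∀ i < R.pos n x, (R.toPath x).edge i = (R.toPath y).edge i) ↔
      ∀ i < n, x.edge i = y.edge i := by
  induction n generalizing x y with
  | zero => simp [pos_zero]
  | succ n ih =>
    have hx := R.toPath_shift x
    have hy := R.toPath_shift y
    have h1 : (∀ i < n + 1, x.edge i = y.edge i) ↔
        x.edge 0 = y.edge 0 ∧ ∀ i < n, (x.shift 1).edge i = (y.shift 1).edge i := by
      rw [Nat.forall_lt_succ_left']
      simp only [shift_edge, add_comm 1]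
    rw [h1, ← ih, pos_succ', ← hx, ← hy]
    constructor
    · intro h
      have h0 : x.edge 0 = y.edge 0 := R.edge_zero_eq fun i hi => h i (by omega)
      refine ⟨h0, fun i hi => ?_⟩
      rw [shift_edge, shift_edge, ← h0]
      exact h _ (by omega)
    · rintro ⟨h0, h⟩ i hi
      rcases Nat.lt_or_ge i (R.blockLength (R.fst (x.edge 0))) with h' | h'
      · exact R.toPath_edge_eq h0 h'
      · obtain ⟨j, rfl⟩ := Nat.exists_eq_add_of_le h'
        have := h j (by omega)
        rwa [shift_edge, shift_edge, ← h0] at this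

/-- Blocks end soon after any position, at a place that can be read off from a single edge. -/
theorem exists_pos_eq (n : ℕ) (x : E.InfPath) :
    ∃ a, R.pos a x = n + R.blockLength ((R.toPath x).edge n) := by
  refine R.block_induction (motive := fun n x =>
    ∃ a, R.pos a x = n + R.blockLength ((R.toPath x).edge n)) (fun x => ?_) (fun x hs => ?_)
    (fun x i h => ?_) n x
  · exact ⟨1, by rw [toPath_edge, pathEdge_zero, pos_succ, pos_zero]⟩
  · refine ⟨1, ?_⟩
    rw [toPath_edge, R.pathEdge_one hs, R.blockLength_of_notMem (R.lst_notMem _), pos_succ,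
      pos_zero, R.blockLength_of_mem hs]
  · obtain ⟨a, ha⟩ := h
    refine ⟨a + 1, ?_⟩
    rw [pos_succ', ha, ← R.toPath_shift, shift_edge, add_assoc]

/-! ### Tail equivalence and lags -/

theorem shift_toPath_eq {x y : E.InfPath} {a b : ℕ} (h : x.shift a = y.shift b) :
    (R.toPath x).shift (R.pos a x) = (R.toPath y).shift (R.pos b y) := by
  rw [toPath_shift_pos, toPath_shift_pos, h]

/-- Equal remainders of recoded paths come, after a few more edges, from equal remainders. -/
theorem exists_shift_eq {x y : E.InfPath} {c d : ℕ}
    (h : (R.toPath x).shift c = (R.toPath y).shift d) :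
    ∃ n a b, R.pos a x = c + n ∧ R.pos b y = d + n ∧ x.shift a = y.shift b := by
  obtain ⟨a, ha⟩ := R.exists_pos_eq c x
  obtain ⟨b, hb⟩ := R.exists_pos_eq d y
  -- The common edge gives both paths the same distance to their next boundary; this distance is the
  -- witness `n`.
  have hcd : (R.toPath x).edge c = (R.toPath y).edge d := congrArg (fun z => InfPath.edge z 0) h
  rw [← hcd] at hb
  refine ⟨_, a, b, ha, hb, R.toPath_injective ?_⟩
  rw [← R.toPath_shift_pos, ← R.toPath_shift_pos, ha, hb]
  exact shift_add_eq h _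

/-- The new lag does not depend on where the paths are cut: two cuts with the same difference differ
by a common `n`, and both positions grow by `R.pos n` of the common remainder. -/
theorem pos_sub_pos_eq {x y : E.InfPath} {a b a' b' : ℕ} (h : x.shift a = y.shift b)
    (h' : x.shift a' = y.shift b') (hk : (a : ℤ) - b = a' - b') :
    (R.pos a x : ℤ) - R.pos b y = R.pos a' x - R.pos b' y := by
  wlog hle : a ≤ a' generalizing a b a' b'
  · exact (this h' h hk.symm (by omega)).symm
  obtain ⟨n, rfl⟩ := Nat.exists_eq_add_of_le hle
  obtain rfl : b' = b + n := by omega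
  rw [pos_add, pos_add, h]
  push_cast
  ring

theorem exists_lag {k : ℤ} {x y : E.InfPath} (h : TailEquiv k x y) :
    ∃ l : ℤ, TailEquiv l (R.toPath x) (R.toPath y) ∧
      ∀ a b : ℕ, k = (a : ℤ) - b → x.shift a = y.shift b →
        l = (R.pos a x : ℤ) - R.pos b y := by
  obtain ⟨a, b, hk, hab⟩ := h.exists_shift_eq
  exact ⟨_, .of_shift_eq (R.shift_toPath_eq hab),
    fun a' b' hk' h' => R.pos_sub_pos_eq hab h' (hk.symm.trans hk')⟩

/-- The arrow of the path groupoid of `F` corresponding to an arrow of that of `E`. -/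
noncomputable def mapHom {x y : E.InfPath} (f : InfPath.Hom x y) :
    InfPath.Hom (R.toPath x) (R.toPath y) where
  lag := (R.exists_lag f.tailEquiv).choose
  tailEquiv := (R.exists_lag f.tailEquiv).choose_spec.1

theorem mapHom_lag {x y : E.InfPath} (f : InfPath.Hom x y) {a b : ℕ}
    (hk : f.lag = (a : ℤ) - b) (h : x.shift a = y.shift b) :
    (R.mapHom f).lag = (R.pos a x : ℤ) - R.pos b y :=
  (R.exists_lag f.tailEquiv).choose_spec.2 a b hk h

/-- The homomorphism of path groupoids given by a recoding. -/
noncomputable def functor : E.InfPath ⥤ F.InfPath where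
  obj := R.toPath
  map f := R.mapHom f
  map_id x := InfPath.Hom.ext (by
    rw [R.mapHom_lag (a := 0) (b := 0) _ rfl rfl, sub_self]
    rfl)
  map_comp {x y z} f g := InfPath.Hom.ext (by
    obtain ⟨a, b, hk, hab⟩ := (InfPath.Hom.tailEquiv f).exists_shift_eq
    obtain ⟨c, d, hl, hcd⟩ := (InfPath.Hom.tailEquiv g).exists_shift_eq
    -- Both arrows are represented so that the middle path `y` is cut at `b + c`; then its two
    -- contributions to the lags cancel.
    have h1 := shift_add_eq hab c
    have h2 := shift_add_eq hcd b
    have h3 : InfPath.Hom.lag f = ((a + c : ℕ) : ℤ) - (b + c : ℕ) := by rw [hk]; push_cast; ring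
    have h4 : InfPath.Hom.lag g = ((c + b : ℕ) : ℤ) - (d + b : ℕ) := by rw [hl]; push_cast; ring
    have h5 : InfPath.Hom.lag (f ≫ g) = ((a + c : ℕ) : ℤ) - (d + b : ℕ) := by
      change InfPath.Hom.lag f + InfPath.Hom.lag g = _
      rw [hk, hl]; push_cast; ring
    change (R.mapHom (f ≫ g)).lag = (R.mapHom f).lag + (R.mapHom g).lag
    rw [R.mapHom_lag _ h3 h1, R.mapHom_lag _ h4 h2,
      R.mapHom_lag _ h5 (h1.trans ((congrArg y.shift (add_comm b c)).trans h2)), add_comm c b]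
    ring)

/-! ### The bijection on arrows and its continuity -/

/-- The map on arrows given by a recoding. -/
noncomputable def arrowMap (g : Arrow E.InfPath) : Arrow F.InfPath := R.functor.mapArrow.obj g

theorem arrowMap_left (g : Arrow E.InfPath) : (R.arrowMap g).left = R.toPath g.left := rfl

theorem arrowMap_right (g : Arrow E.InfPath) : (R.arrowMap g).right = R.toPath g.right := rfl

theorem arrowLag_arrowMap {g : Arrow E.InfPath} {a b : ℕ} (hk : arrowLag g = (a : ℤ) - b)
    (h : g.left.shift a = g.right.shift b) :
    arrowLag (R.arrowMap g) = (R.pos a g.left : ℤ) - R.pos b g.right :=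
  R.mapHom_lag _ hk h

theorem exists_arrowLag (g : Arrow E.InfPath) :
    ∃ a b : ℕ, arrowLag g = (a : ℤ) - b ∧ g.left.shift a = g.right.shift b :=
  (InfPath.Hom.tailEquiv g.hom).exists_shift_eq

theorem arrowMap_injective : Function.Injective R.arrowMap := by
  intro g h hgh
  have hl : g.left = h.left := R.toPath_injective (by
    rw [← arrowMap_left, hgh, arrowMap_left])
  have hr : g.right = h.right := R.toPath_injective (by
    rw [← arrowMap_right, hgh, arrowMap_right])
  refine arrow_ext hl hr ?_
  obtain ⟨a, b, hk, hab⟩ := exists_arrowLag g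
  obtain ⟨c, d, hl', hcd⟩ := exists_arrowLag h
  -- Once both arrows cut the right path at `b + d`, equal images have equal positions on the left
  -- path, and `pos` is injective in its index.
  have h1 := R.arrowLag_arrowMap (a := a + d) (b := b + d) (by rw [hk]; push_cast; ring)
    (shift_add_eq hab d)
  have h2 := R.arrowLag_arrowMap (a := c + b) (b := d + b) (by rw [hl']; push_cast; ring)
    (shift_add_eq hcd b)
  rw [hgh, h2, hl, hr, add_comm b d] at h1
  have h3 : R.pos (c + b) h.left = R.pos (a + d) h.left := by omega
  have h4 : c + b = a + d := (R.pos_strictMono h.left).injective h3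
  rw [hk, hl']
  omega

theorem arrowMap_surjective : Function.Surjective R.arrowMap := by
  intro h
  obtain ⟨x, hx⟩ : ∃ x, R.toPath x = h.left := ⟨_, R.toPath_ofPath _⟩
  obtain ⟨y, hy⟩ : ∃ y, R.toPath y = h.right := ⟨_, R.toPath_ofPath _⟩
  obtain ⟨c, d, hk, hcd⟩ := exists_arrowLag h
  rw [← hx, ← hy] at hcd
  -- The given cut need not lie at block boundaries; the `n` extra edges that lead there cancel in
  -- the lag.
  obtain ⟨n, a, b, ha, hb, hab⟩ := R.exists_shift_eq hcd
  let f : x ⟶ y := ⟨(a : ℤ) - b, .of_shift_eq hab⟩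
  refine ⟨Arrow.mk f, arrow_ext hx hy ?_⟩
  have := R.arrowLag_arrowMap (g := Arrow.mk f) (a := a) (b := b) rfl hab
  rw [this, hk]
  change (R.pos a x : ℤ) - R.pos b y = c - d
  rw [ha, hb]
  push_cast
  ring

/-- At block boundaries the neighbourhoods correspond exactly: edges by `forall_edge_eq_iff`,
remainders by injectivity of `toPath`, and lags because `pos` is strictly increasing. -/
theorem arrowMap_mem_arrowNhd_iff {g g' : Arrow E.InfPath} {a b : ℕ} :
    R.arrowMap g' ∈ arrowNhd (R.pos a g.left) (R.pos b g.right) (R.arrowMap g).left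
      (R.arrowMap g).right ↔ g' ∈ arrowNhd a b g.left g.right := by
  simp only [arrowNhd, Set.mem_ofPred_eq, arrowMap_left, arrowMap_right]
  have key : ∀ (x y : E.InfPath) (n : ℕ),
      (∀ i < R.pos n x, (R.toPath y).edge i = (R.toPath x).edge i) ↔
        ∀ i < n, y.edge i = x.edge i := fun x y n => by
    simpa only [eq_comm] using R.forall_edge_eq_iff (n := n) (x := x) (y := y)
  rw [key, key]
  refine and_congr_right fun h1 => and_congr_right fun h2 => ?_
  rw [← R.pos_eq_of_edge_eq h1, ← R.pos_eq_of_edge_eq h2, R.toPath_shift_pos, R.toPath_shift_pos,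
    R.toPath_injective.eq_iff]
  refine and_congr_right fun h3 => and_congr ?_ ?_
  · rw [R.pos_eq_of_edge_eq h1, R.toPath_shift_pos, R.toPath_source, R.toPath_source,
      R.vertexEquiv.injective.eq_iff]
  · constructor
    · intro h4
      obtain ⟨c, d, hl, hcd⟩ := exists_arrowLag g'
      have h5 := R.arrowLag_arrowMap (a := c + b) (b := d + b) (by rw [hl]; push_cast; ring)
        (shift_add_eq hcd b)
      have h6 : (R.pos (a + d) g'.left : ℤ) - R.pos (b + d) g'.right
          = R.pos a g'.left - R.pos b g'.right := by
        rw [pos_add, pos_add, h3]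
        push_cast
        ring
      rw [h4, ← h6, add_comm d b] at h5
      have h7 : R.pos (a + d) g'.left = R.pos (c + b) g'.left := by omega
      have h8 : a + d = c + b := (R.pos_strictMono g'.left).injective h7
      rw [hl]
      omega
    · exact fun h4 => R.arrowLag_arrowMap h4 h3

/-- A cylinder of `F` may end inside a block. Around each image point it is shrunk to the next block
boundaries, where `arrowMap_mem_arrowNhd_iff` applies. -/
theorem continuous_arrowMap : Continuous R.arrowMap := by
  refine continuous_generateFrom_iff.2 ?_
  rintro _ ⟨v, v', w, α, β, rfl⟩
  refine isOpen_arrow_of_forall fun g hg => ?_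
  have hc := cylinder_eq_arrowNhd hg
  have hs := shift_eq_of_mem_cylinder hg
  obtain ⟨n, a, b, ha, hb, hab⟩ := R.exists_shift_eq hs
  have hlag : arrowLag (R.arrowMap g) = (α.length : ℤ) - β.length := by
    have := hg
    rw [hc] at this
    exact this.2.2.2.2
  -- The arrow with the same ends and lag `a - b` has the same image as `g`, so it equals `g`.
  have hk : arrowLag g = (a : ℤ) - b := by
    let f : g.left ⟶ g.right := ⟨(a : ℤ) - b, .of_shift_eq hab⟩
    have h1 : R.arrowMap (Arrow.mk f) = R.arrowMap g := by
      refine arrow_ext rfl rfl ?_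
      refine (R.arrowLag_arrowMap (g := Arrow.mk f) (a := a) (b := b) rfl hab).trans ?_
      rw [hlag]
      change (R.pos a g.left : ℤ) - R.pos b g.right = _
      rw [ha, hb]
      push_cast
      ring
    rw [← R.arrowMap_injective h1]
    rfl
  refine ⟨a, b, hk, hab, fun g' hg' => ?_⟩
  rw [Set.mem_preimage, hc]
  refine arrowNhd_add_subset hs n ?_
  rw [← ha, ← hb]
  exact R.arrowMap_mem_arrowNhd_iff.2 hg'

theorem isOpen_image_cylinder {v v' w : E.Vertex} (α : Quiver.Path v w)
    (β : Quiver.Path v' w) : IsOpen (R.arrowMap '' cylinder α β) := by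
  refine isOpen_arrow_of_forall ?_
  rintro _ ⟨g, hg, rfl⟩
  have hc := cylinder_eq_arrowNhd hg
  have hs := shift_eq_of_mem_cylinder hg
  have hk : arrowLag g = (α.length : ℤ) - β.length := by
    rw [hc] at hg
    exact hg.2.2.2.2
  refine ⟨_, _, R.arrowLag_arrowMap hk hs, R.shift_toPath_eq hs, fun h hh => ?_⟩
  obtain ⟨g', rfl⟩ := R.arrowMap_surjective h
  refine ⟨g', ?_, rfl⟩
  rw [hc]
  exact R.arrowMap_mem_arrowNhd_iff.1 hh

theorem isHomeomorph_arrowMap : IsHomeomorph R.arrowMap := by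
  let ε : Arrow E.InfPath ≃ Arrow F.InfPath :=
    .ofBijective R.arrowMap ⟨R.arrowMap_injective, R.arrowMap_surjective⟩
  have hε : Continuous ε.symm := by
    refine continuous_generateFrom_iff.2 ?_
    rintro _ ⟨v, v', w, α, β, rfl⟩
    rw [← Equiv.image_eq_preimage_symm]
    exact R.isOpen_image_cylinder α β
  exact (Homeomorph.mk ε R.continuous_arrowMap hε).isHomeomorph

theorem topologicalGroupoidIso {E F : DirectedGraph.{u}} (R : EdgeRecoding E F) :
    TopologicalGroupoidIso E.InfPath F.InfPath :=
  ⟨R.functor, R.isHomeomorph_arrowMap⟩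

end EdgeRecoding

/-! ### Isomorphism of topological groupoids is an equivalence relation -/

section GroupoidIso

theorem TopologicalGroupoidIso.refl (G : Type*) [Groupoid G] [TopologicalSpace (Arrow G)] :
    TopologicalGroupoidIso G G :=
  ⟨𝟭 G, IsHomeomorph.id⟩

theorem TopologicalGroupoidIso.trans {G H K : Type*} [Groupoid G] [Groupoid H] [Groupoid K]
    [TopologicalSpace (Arrow G)] [TopologicalSpace (Arrow H)] [TopologicalSpace (Arrow K)]
    (h : TopologicalGroupoidIso G H) (h' : TopologicalGroupoidIso H K) :
    TopologicalGroupoidIso G K := by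
  obtain ⟨φ, hφ⟩ := h
  obtain ⟨ψ, hψ⟩ := h'
  exact ⟨φ ⋙ ψ, hψ.comp hφ⟩

/-- A functor that is bijective on arrows has an inverse functor. -/
theorem exists_inverse_functor {G H : Type*} [Category G] [Category H] (φ : G ⥤ H)
    (hφ : Function.Bijective (φ.mapArrow.obj : Arrow G → Arrow H)) :
    ∃ ψ : H ⥤ G, ∀ g : Arrow H, φ.mapArrow.obj (ψ.mapArrow.obj g) = g := by
  -- Objects are seen through their identity arrows.
  have hinj : Function.Injective φ.obj := fun x y hxy => by
    have h : Arrow.mk (φ.map (𝟙 x)) = Arrow.mk (φ.map (𝟙 y)) := by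
      rw [φ.map_id, φ.map_id, hxy]
    exact congrArg Comma.left (hφ.1 (a₁ := Arrow.mk (𝟙 x)) (a₂ := Arrow.mk (𝟙 y)) h)
  have hsurj : ∀ y, ∃ x, φ.obj x = y := fun y => by
    obtain ⟨g, hg⟩ := hφ.2 (Arrow.mk (𝟙 y))
    exact ⟨g.left, congrArg Comma.left hg⟩
  have hfaithful : ∀ {x y : G} {f f' : x ⟶ y}, φ.map f = φ.map f' → f = f' :=
    fun {x y f f'} h => by
      have h1 : φ.mapArrow.obj (Arrow.mk f) = φ.mapArrow.obj (Arrow.mk f') :=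
        congrArg Arrow.mk h
      exact Arrow.mk_injective _ _ (hφ.1 h1)
  have hfull : ∀ {x y : G} (g : φ.obj x ⟶ φ.obj y), ∃ f : x ⟶ y, φ.map f = g := fun {x y} g => by
    obtain ⟨⟨x', y', f⟩, hf⟩ := hφ.2 (Arrow.mk g)
    have hx : x' = x := hinj (congrArg Comma.left hf)
    have hy : y' = y := hinj (congrArg Comma.right hf)
    change G at x' y'
    subst hx hy
    refine ⟨f, ?_⟩
    have h1 : Arrow.mk (φ.map f) = Arrow.mk g := hf
    exact Arrow.mk_injective _ _ h1
  choose o ho using hsurj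
  choose m hm using @hfull
  let ψ : H ⥤ G :=
    { obj := o
      map := fun {x y} g => m (eqToHom (ho x) ≫ g ≫ eqToHom (ho y).symm)
      map_id := fun x => hfaithful (by simp [hm])
      map_comp := fun f g => hfaithful (by simp [hm]) }
  refine ⟨ψ, fun g => Arrow.ext (ho _) (ho _) ?_⟩
  exact hm _

theorem TopologicalGroupoidIso.symm {G H : Type*} [Groupoid G] [Groupoid H]
    [TopologicalSpace (Arrow G)] [TopologicalSpace (Arrow H)] (h : TopologicalGroupoidIso G H) :
    TopologicalGroupoidIso H G := by
  obtain ⟨φ, hφ⟩ := h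
  obtain ⟨ψ, hψ⟩ := exists_inverse_functor φ hφ.bijective
  refine ⟨ψ, ?_⟩
  have : (ψ.mapArrow.obj : Arrow H → Arrow G) = (hφ.homeomorph _).symm :=
    funext fun g => ((hφ.homeomorph _).symm_apply_eq.2 (hψ g).symm).symm
  rw [this]
  exact (hφ.homeomorph _).symm.isHomeomorph

end GroupoidIso

/-! ### Relations in Cuntz-Krieger families -/

/-- Projections whose sum is a projection are mutually orthogonal. -/
theorem mul_eq_zero_of_isStarProjection_sum {A : Type*} [NonUnitalCStarAlgebra A] {ι : Type*}
    {s : Finset ι} {p : ι → A} (hp : ∀ i ∈ s, IsStarProjection (p i))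
    (hs : IsStarProjection (∑ i ∈ s, p i)) {i j : ι} (hi : i ∈ s) (hj : j ∈ s) (hij : i ≠ j) :
    p i * p j = 0 := by
  classical
  let _ : PartialOrder A := CStarAlgebra.spectralOrder A
  have _ : StarOrderedRing A := CStarAlgebra.spectralOrderedRing A
  have hle : p i ≤ ∑ i ∈ s, p i := Finset.single_le_sum (fun k hk => (hp k hk).nonneg) hi
  have h1 : (∑ k ∈ s, p k) * p i = p i := ((hp i hi).le_iff_mul_eq_right hs).1 hle
  have hstar : ∀ k ∈ s, star (p k) = p k := fun k hk => (hp k hk).isSelfAdjoint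
  have hsq : ∀ k ∈ s, p k * p k = p k := fun k hk => (hp k hk).isIdempotentElem
  -- Compressing the sum by `p i` leaves only `p i`, so the other summands add up to zero. Each is
  -- `star (p k * p i) * (p k * p i)`, hence positive, hence zero.
  have h2 : ∑ k ∈ s.erase i, p i * p k * p i = 0 := by
    have h3 : ∑ k ∈ s, p i * p k * p i = p i := by
      rw [← Finset.sum_mul, ← Finset.mul_sum, mul_assoc, h1, hsq i hi]
    rw [← Finset.add_sum_erase s _ hi, hsq i hi, hsq i hi] at h3
    simpa using h3
  have h4 : ∀ k ∈ s, p i * p k * p i = star (p k * p i) * (p k * p i) := fun k hk => by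
    rw [star_mul, hstar k hk, hstar i hi, mul_assoc, mul_assoc, ← mul_assoc (p k) (p k), hsq k hk]
  have h5 := (Finset.sum_eq_zero_iff_of_nonneg fun k hk => by
    rw [h4 k (Finset.mem_of_mem_erase hk)]
    exact star_mul_self_nonneg _).1 h2 j (Finset.mem_erase.2 ⟨hij.symm, hj⟩)
  rw [h4 j hj, CStarRing.star_mul_self_eq_zero_iff] at h5
  have h6 := congrArg star h5
  rwa [star_mul, hstar i hi, hstar j hj, star_zero] at h6

namespace CKFamily

variable {E : DirectedGraph.{u}} {A : Type v} [NonUnitalCStarAlgebra A] (t : CKFamily E A)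

theorem S_mul_P (e : E.Edge) : t.S e * t.P (E.rng e) = t.S e := by
  rw [← t.star_mul_self, ← mul_assoc, t.partialIsometry]

theorem P_mul_star_S (e : E.Edge) : t.P (E.rng e) * star (t.S e) = star (t.S e) := by
  have := congrArg star (t.S_mul_P e)
  rwa [star_mul, (t.isStarProjection _).isSelfAdjoint.star_eq] at this

theorem star_S_mul_range (e : E.Edge) : star (t.S e) * (t.S e * star (t.S e)) = star (t.S e) := by
  rw [← mul_assoc, t.star_mul_self, P_mul_star_S]

theorem isStarProjection_range (e : E.Edge) : IsStarProjection (t.S e * star (t.S e)) :=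
  ⟨by rw [IsIdempotentElem, ← mul_assoc, t.partialIsometry], .mul_star_self _⟩

/-- By the relation at the common source, the range projections sum to a projection, hence are
mutually orthogonal. -/
theorem star_S_mul_S_of_src_eq (hE : E.RowFinite) {e f : E.Edge} (hef : e ≠ f)
    (h : E.src e = E.src f) : star (t.S e) * t.S f = 0 := by
  have hsum := t.sum_eq _ (hE (E.src e)) ⟨e, rfl⟩
  have hz := mul_eq_zero_of_isStarProjection_sum (s := (hE (E.src e)).toFinset)
    (p := fun e => t.S e * star (t.S e)) (fun i _ => t.isStarProjection_range i)
    (by rw [← hsum]; exact t.isStarProjection _) (i := e) (j := f) (by simp) (by simp [h]) hef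
  rw [← t.star_S_mul_range e, ← t.partialIsometry f]
  calc star (t.S e) * (t.S e * star (t.S e)) * (t.S f * star (t.S f) * t.S f)
      = star (t.S e) * (t.S e * star (t.S e) * (t.S f * star (t.S f))) * t.S f := by
        simp only [mul_assoc]
    _ = 0 := by rw [hz, mul_zero, zero_mul]

theorem P_mul_S (hE : E.RowFinite) (e : E.Edge) : t.P (E.src e) * t.S e = t.S e := by
  rw [t.sum_eq _ (hE (E.src e)) ⟨e, rfl⟩, Finset.sum_mul, Finset.sum_eq_single e]
  · exact t.partialIsometry e
  · intro f hf hfe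
    have hf' : E.src f = E.src e := by simpa using hf
    rw [mul_assoc, t.star_S_mul_S_of_src_eq hE hfe hf', mul_zero]
  · simp

theorem star_S_mul_S (hE : E.RowFinite) {e f : E.Edge} (hef : e ≠ f) :
    star (t.S e) * t.S f = 0 := by
  by_cases h : E.src e = E.src f
  · exact t.star_S_mul_S_of_src_eq hE hef h
  · have he : star (t.S e) * t.P (E.src e) = star (t.S e) := by
      have := congrArg star (t.P_mul_S hE e)
      rwa [star_mul, (t.isStarProjection _).isSelfAdjoint.star_eq] at this
    rw [← he, ← t.P_mul_S hE f, mul_assoc, ← mul_assoc (t.P _), t.orthogonal _ _ h, zero_mul,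
      mul_zero]

end CKFamily

/-! ### Recodings of Cuntz-Krieger families -/

namespace EdgeRecoding

variable {E F : DirectedGraph.{u}} (R : EdgeRecoding E F) {A : Type v} [NonUnitalCStarAlgebra A]

theorem fst_injOn {e e' : E.Edge} (h : R.fst e ∉ R.split) (he : R.fst e = R.fst e') : e = e' :=
  R.edge_ext _ _ he (by rw [R.lst_eq _ h, R.lst_eq _ (he ▸ h), he])

/-- An edge is determined by the two ends of its block. The first end is emitted by the given
vertex; the last is the first itself or is emitted by its range. -/
theorem rowFinite {E F : DirectedGraph.{u}} (R : EdgeRecoding E F) (hF : F.RowFinite) : E.RowFinite := fun v => by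
  have h1 := (hF (R.vertexEquiv v)).biUnion fun f _ =>
    ((Set.finite_singleton f).union (hF (F.rng f))).image fun g => (f, g)
  refine (h1.preimage (f := fun e => (R.fst e, R.lst e)) ?_).subset fun e he => ?_
  · intro e _ e' _ h
    exact R.edge_ext _ _ (congrArg Prod.fst h) (congrArg Prod.snd h)
  · have he : E.src e = v := he
    simp only [Set.mem_preimage, Set.mem_iUnion]
    refine ⟨R.fst e, (R.src_fst e).trans (congrArg _ he), R.lst e, ?_, rfl⟩
    by_cases h : R.fst e ∈ R.split
    · exact Or.inr (R.consecutive e h).symm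
    · exact Or.inl (R.lst_eq e h)

theorem fst_surjective (hF : F.NoSinks) : Function.Surjective R.fst := fun f => by
  by_cases hf : f ∈ R.split
  · obtain ⟨g, hg⟩ := hF (F.rng f)
    obtain ⟨e, he, -⟩ := R.exists_pair f hf g hg.symm
    exact ⟨e, he⟩
  · exact R.exists_single f hf

theorem noSinks {E F : DirectedGraph.{u}} (R : EdgeRecoding E F) (hF : F.NoSinks) : E.NoSinks := fun v => by
  obtain ⟨f, hf⟩ := hF (R.vertexEquiv v)
  obtain ⟨e, rfl⟩ := R.fst_surjective hF f
  exact ⟨e, R.vertexEquiv.injective ((R.src_fst e).symm.trans hf)⟩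

open Classical in
/-- The partial isometries of the Cuntz-Krieger `E`-family obtained from an `F`-family. -/
noncomputable def pullS (t : CKFamily F A) (e : E.Edge) : A :=
  if R.fst e ∈ R.split then t.S (R.fst e) * t.S (R.lst e) else t.S (R.fst e)

theorem pullS_of_mem (t : CKFamily F A) {e : E.Edge} (h : R.fst e ∈ R.split) :
    R.pullS t e = t.S (R.fst e) * t.S (R.lst e) := if_pos h

theorem pullS_of_notMem (t : CKFamily F A) {e : E.Edge} (h : R.fst e ∉ R.split) :
    R.pullS t e = t.S (R.fst e) := if_neg h

theorem star_pullS_mul_pullS (hF : F.RowFinite) (t : CKFamily F A) (e : E.Edge) :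
    star (R.pullS t e) * R.pullS t e = t.P (R.vertexEquiv (E.rng e)) := by
  rw [← R.rng_lst]
  by_cases h : R.fst e ∈ R.split
  · rw [R.pullS_of_mem t h, star_mul, mul_assoc, ← mul_assoc (star (t.S (R.fst e))),
      t.star_mul_self, R.consecutive e h, t.P_mul_S hF, t.star_mul_self]
  · rw [R.pullS_of_notMem t h, t.star_mul_self, R.lst_eq e h]

theorem pullS_mul_P (t : CKFamily F A) (e : E.Edge) :
    R.pullS t e * t.P (R.vertexEquiv (E.rng e)) = R.pullS t e := by
  rw [← R.rng_lst]
  by_cases h : R.fst e ∈ R.split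
  · rw [R.pullS_of_mem t h, mul_assoc, t.S_mul_P]
  · rw [R.pullS_of_notMem t h, R.lst_eq e h, t.S_mul_P]

/-- The Cuntz-Krieger `E`-family obtained from an `F`-family. -/
noncomputable def pullFamily (hF : F.RowFinite) (hF' : F.NoSinks) (t : CKFamily F A) :
    CKFamily E A where
  P v := t.P (R.vertexEquiv v)
  S := R.pullS t
  isStarProjection v := t.isStarProjection _
  orthogonal v w h := t.orthogonal _ _ (R.vertexEquiv.injective.ne h)
  partialIsometry e := by rw [mul_assoc, R.star_pullS_mul_pullS hF, R.pullS_mul_P]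
  star_mul_self := R.star_pullS_mul_pullS hF t
  sum_eq v h _ := by
    classical
    rw [t.sum_eq _ (hF (R.vertexEquiv v)) (hF' _)]
    -- The edges of `E` at `v` are grouped by the first edge of their blocks; each group must sum to
    -- the range projection of that edge.
    rw [← Finset.sum_fiberwise_of_maps_to (g := R.fst) (t := (hF (R.vertexEquiv v)).toFinset)
      (fun e he => by
        have he' : E.src e = v := by simpa using he
        simp [R.src_fst, he'])]
    refine Finset.sum_congr rfl fun f hf => ?_
    have hf' : F.src f = R.vertexEquiv v := by simpa using hf
    have hsrc : ∀ e, R.fst e = f → E.src e = v := fun e he =>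
      R.vertexEquiv.injective (by rw [← R.src_fst, he, hf'])
    by_cases hs : f ∈ R.split
    -- The projection at the range of `f` is inserted and expanded by the relation there, giving one
    -- term for each block `f g`.
    · have h1 : t.S f * star (t.S f) = ∑ g ∈ (hF (F.rng f)).toFinset,
          t.S f * t.S g * star (t.S f * t.S g) := by
        conv_lhs => rw [← t.S_mul_P f, mul_assoc, star_mul,
          (t.isStarProjection _).isSelfAdjoint.star_eq, ← mul_assoc (t.P _),
          (t.isStarProjection _).isIdempotentElem.eq,
          t.sum_eq _ (hF (F.rng f)) (hF' _), Finset.sum_mul, Finset.mul_sum]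
        refine Finset.sum_congr rfl fun g _ => ?_
        simp only [star_mul, mul_assoc]
      rw [h1]
      symm
      refine Finset.sum_bij (fun e _ => R.lst e) (fun e he => ?_) (fun e he e' he' hee => ?_)
        (fun g hg => ?_) (fun e he => ?_)
      · have he' : R.fst e = f := (Finset.mem_filter.1 he).2
        have := R.consecutive e (he' ▸ hs)
        simp [← this, he']
      · exact R.edge_ext _ _
          ((Finset.mem_filter.1 he).2.trans (Finset.mem_filter.1 he').2.symm) hee
      · have hg' : F.src g = F.rng f := by simpa using hg
        obtain ⟨e, he, hge⟩ := R.exists_pair f hs g hg'.symm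
        exact ⟨e, by simp [hsrc e he, he], hge⟩
      · have he' : R.fst e = f := (Finset.mem_filter.1 he).2
        rw [R.pullS_of_mem t (he' ▸ hs), he']
    · obtain ⟨e, rfl⟩ := R.exists_single f hs
      rw [Finset.sum_eq_single e]
      · rw [R.pullS_of_notMem t hs]
      · intro e' he' hne
        exact absurd (R.fst_injOn hs (Finset.mem_filter.1 he').2.symm).symm hne
      · intro he
        exact (he (Finset.mem_filter.2 ⟨h.mem_toFinset.2 (hsrc e rfl), rfl⟩)).elim

/-! ### The inverse construction: `F`-families from `E`-families -/

section Push

variable (hE : E.RowFinite) (hF' : F.NoSinks)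

/-- Some edge of `E` whose replacement starts with a given edge of `F`. -/
noncomputable def lift (f : F.Edge) : E.Edge := Function.surjInv (R.fst_surjective hF') f

theorem fst_lift (f : F.Edge) : R.fst (R.lift hF' f) = f :=
  Function.surjInv_eq (R.fst_surjective hF') f

theorem lift_fst {e : E.Edge} (h : R.fst e ∉ R.split) : R.lift hF' (R.fst e) = e :=
  (R.fst_injOn h (R.fst_lift hF' _).symm).symm

theorem finite_fiber (hE : E.RowFinite) (f : F.Edge) : {e | R.fst e = f}.Finite :=
  (hE (R.vertexEquiv.symm (F.src f))).subset fun e he => by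
    have he : R.fst e = f := he
    change E.src e = _
    rw [← he, R.src_fst, Equiv.symm_apply_apply]

/-- The edges of `E` whose replacements start with a given edge of `F`. -/
noncomputable def fiber (f : F.Edge) : Finset E.Edge := (R.finite_fiber hE f).toFinset

theorem mem_fiber {f : F.Edge} {e : E.Edge} : e ∈ R.fiber hE f ↔ R.fst e = f := by
  simp [fiber]

theorem fiber_of_notMem {f : F.Edge} (h : f ∉ R.split) : R.fiber hE f = {R.lift hF' f} := by
  ext e
  rw [R.mem_fiber, Finset.mem_singleton]
  constructor
  · rintro rfl
    exact (R.lift_fst hF' h).symm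
  · rintro rfl
    exact R.fst_lift hF' f

/-- The edge of `E` that is replaced by the last edge of the replacement of a given edge. -/
noncomputable def last (e : E.Edge) : E.Edge := R.lift hF' (R.lst e)

theorem fst_last (e : E.Edge) : R.fst (R.last hF' e) = R.lst e := R.fst_lift hF' _

theorem rng_last (e : E.Edge) : E.rng (R.last hF' e) = E.rng e := by
  apply R.vertexEquiv.injective
  rw [← R.rng_lst, ← R.rng_lst, R.lst_eq _ (by rw [fst_last]; exact R.lst_notMem e), fst_last]

theorem last_ne {e e' : E.Edge} (h : R.fst e = R.fst e') (hne : e ≠ e') :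
    R.last hF' e ≠ R.last hF' e' := fun h' => hne <| R.edge_ext _ _ h <| by
  rw [← R.fst_last hF', h', R.fst_last hF']

open Classical in
/-- The partial isometries of the Cuntz-Krieger `F`-family obtained from an `E`-family. -/
noncomputable def pushS (t : CKFamily E A) (f : F.Edge) : A :=
  if f ∈ R.split then ∑ e ∈ R.fiber hE f, t.S e * star (t.S (R.last hF' e))
  else t.S (R.lift hF' f)

theorem pushS_of_mem (t : CKFamily E A) {f : F.Edge} (h : f ∈ R.split) :
    R.pushS hE hF' t f = ∑ e ∈ R.fiber hE f, t.S e * star (t.S (R.last hF' e)) := if_pos h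

theorem pushS_of_notMem (t : CKFamily E A) {f : F.Edge} (h : f ∉ R.split) :
    R.pushS hE hF' t f = t.S (R.lift hF' f) := if_neg h

/-- As `e` runs over the blocks starting with a split edge `f`, `last e` runs once over the edges
emitted at the range of `f`; the sum is the relation at that vertex. -/
theorem sum_last (t : CKFamily E A) {f : F.Edge} (h : f ∈ R.split) :
    ∑ e ∈ R.fiber hE f, t.S (R.last hF' e) * star (t.S (R.last hF' e))
      = t.P (R.vertexEquiv.symm (F.rng f)) := by
  rw [t.sum_eq _ (hE _) (R.noSinks hF' _)]
  refine Finset.sum_bij (fun e _ => R.last hF' e) (fun e he => ?_) (fun e he e' he' hee => ?_)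
    (fun g hg => ?_) (fun e he => rfl)
  · have he' := (R.mem_fiber hE).1 he
    have h1 := R.consecutive e (he' ▸ h)
    rw [he', ← R.fst_last hF', R.src_fst] at h1
    simp [h1]
  · by_contra hne
    exact R.last_ne hF' (((R.mem_fiber hE).1 he).trans ((R.mem_fiber hE).1 he').symm) hne hee
  · have hg' : E.src g = R.vertexEquiv.symm (F.rng f) := by simpa using hg
    have h1 : F.rng f = F.src (R.fst g) := by rw [R.src_fst, hg', Equiv.apply_symm_apply]
    obtain ⟨e, he, hge⟩ := R.exists_pair f h _ h1
    refine ⟨e, (R.mem_fiber hE).2 he, ?_⟩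
    rw [last, hge, R.lift_fst hF' (R.notMem_of_consecutive _ h _ h1)]

/-- For split `f` the cross terms contain `star (S e) * S e'` with `e ≠ e'` and vanish; the diagonal
ones collapse because `e` and `last e` have the same range. -/
theorem star_pushS_mul_pushS (t : CKFamily E A) (f : F.Edge) :
    star (R.pushS hE hF' t f) * R.pushS hE hF' t f = t.P (R.vertexEquiv.symm (F.rng f)) := by
  by_cases h : f ∈ R.split
  · rw [R.pushS_of_mem hE hF' t h, ← R.sum_last hE hF' t h, star_sum, Finset.sum_mul]
    refine Finset.sum_congr rfl fun e he => ?_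
    rw [Finset.mul_sum, Finset.sum_eq_single e]
    · rw [star_mul, star_star, mul_assoc, ← mul_assoc (star (t.S e)), t.star_mul_self,
        ← R.rng_last hF' e, t.P_mul_star_S]
    · intro e' _ hne
      rw [star_mul, star_star, mul_assoc, ← mul_assoc (star (t.S e)),
        t.star_S_mul_S hE hne.symm, zero_mul, mul_zero]
    · exact fun h' => absurd he h'
  · rw [R.pushS_of_notMem hE hF' t h, t.star_mul_self]
    congr 1
    apply R.vertexEquiv.injective
    rw [← R.rng_lst, R.lst_eq _ (by rwa [R.fst_lift]), R.fst_lift, Equiv.apply_symm_apply]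

theorem pushS_mul_star_pushS (t : CKFamily E A) (f : F.Edge) :
    R.pushS hE hF' t f * star (R.pushS hE hF' t f)
      = ∑ e ∈ R.fiber hE f, t.S e * star (t.S e) := by
  by_cases h : f ∈ R.split
  · rw [R.pushS_of_mem hE hF' t h, star_sum, Finset.sum_mul]
    refine Finset.sum_congr rfl fun e he => ?_
    rw [Finset.mul_sum, Finset.sum_eq_single e]
    · rw [star_mul, star_star, mul_assoc, ← mul_assoc (star _), t.star_mul_self,
        R.rng_last hF' e, t.P_mul_star_S]
    · intro e' he' hne
      have := R.last_ne hF' (((R.mem_fiber hE).1 he).trans ((R.mem_fiber hE).1 he').symm) hne.symm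
      rw [star_mul, star_star, mul_assoc, ← mul_assoc (star _), t.star_S_mul_S hE this, zero_mul,
        mul_zero]
    · exact fun h' => absurd he h'
  · rw [R.pushS_of_notMem hE hF' t h, R.fiber_of_notMem hE hF' h, Finset.sum_singleton]

theorem pushS_mul_P (t : CKFamily E A) (f : F.Edge) :
    R.pushS hE hF' t f * t.P (R.vertexEquiv.symm (F.rng f)) = R.pushS hE hF' t f := by
  by_cases h : f ∈ R.split
  · rw [R.pushS_of_mem hE hF' t h, Finset.sum_mul]
    refine Finset.sum_congr rfl fun e he => ?_
    have he' := (R.mem_fiber hE).1 he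
    have h1 := R.consecutive e (he' ▸ h)
    rw [he', ← R.fst_last hF', R.src_fst] at h1
    have h2 := congrArg star (t.P_mul_S hE (R.last hF' e))
    rw [star_mul, (t.isStarProjection _).isSelfAdjoint.star_eq] at h2
    rw [h1, Equiv.symm_apply_apply, mul_assoc, h2]
  · have h1 := t.S_mul_P (R.lift hF' f)
    have h2 : R.vertexEquiv.symm (F.rng f) = E.rng (R.lift hF' f) := by
      rw [Equiv.symm_apply_eq, ← R.rng_lst, R.lst_eq _ (by rwa [R.fst_lift]), R.fst_lift]
    rw [R.pushS_of_notMem hE hF' t h, h2, h1]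

/-- The Cuntz-Krieger `F`-family obtained from an `E`-family. -/
noncomputable def pushFamily (t : CKFamily E A) : CKFamily F A where
  P w := t.P (R.vertexEquiv.symm w)
  S := R.pushS hE hF' t
  isStarProjection v := t.isStarProjection _
  orthogonal v w h := t.orthogonal _ _ (R.vertexEquiv.symm.injective.ne h)
  partialIsometry f := by rw [mul_assoc, R.star_pushS_mul_pushS, R.pushS_mul_P]
  star_mul_self := R.star_pushS_mul_pushS hE hF' t
  sum_eq w h _ := by
    classical
    rw [t.sum_eq _ (hE _) (R.noSinks hF' _)]
    rw [← Finset.sum_fiberwise_of_maps_to (g := R.fst) (t := h.toFinset) (fun e he => by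
        have he' : E.src e = R.vertexEquiv.symm w := by simpa using he
        simp [R.src_fst, he'])]
    refine Finset.sum_congr rfl fun f hf => ?_
    have hf' : F.src f = w := by simpa using hf
    rw [R.pushS_mul_star_pushS]
    refine Finset.sum_congr ?_ fun _ _ => rfl
    ext e
    rw [R.mem_fiber, Finset.mem_filter, and_iff_right_iff_imp]
    intro he
    simp only [Set.Finite.mem_toFinset]
    change E.src e = _
    rw [Equiv.eq_symm_apply, ← R.src_fst, he, hf']

end Push

/-- A recoding induces an isomorphism of graph algebras. -/
theorem nonempty_graphCStarAlgebra_equiv {E F : DirectedGraph.{u}} (R : EdgeRecoding E F)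
    (hF : F.RowFinite) (hF' : F.NoSinks) :
    Nonempty (E.GraphCStarAlgebra ≃⋆ₐ[ℂ] F.GraphCStarAlgebra) := by
  have hE : E.RowFinite := R.rowFinite hF
  obtain ⟨φ, ⟨hφP, hφS⟩, -⟩ := existsUnique_lift (R.pullFamily hF hF' (universalFamily F))
  obtain ⟨ψ, ⟨hψP, hψS⟩, -⟩ := existsUnique_lift (R.pushFamily hE hF' (universalFamily E))
  refine ⟨StarAlgEquiv.ofNonUnitalStarAlgHom φ ψ ?_ ?_⟩
  · refine hom_eq_of_eq_on_generators _ _ (fun v => ?_) (fun e => ?_)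
    · change ψ (φ _) = _
      rw [hφP]
      change ψ ((universalFamily F).P _) = _
      rw [hψP]
      change (universalFamily E).P _ = _
      rw [Equiv.symm_apply_apply]
      rfl
    · change ψ (φ _) = (universalFamily E).S e
      rw [hφS]
      change ψ (R.pullS _ e) = _
      by_cases h : R.fst e ∈ R.split
      · rw [R.pullS_of_mem _ h, map_mul, hψS, hψS]
        change R.pushS hE hF' _ _ * R.pushS hE hF' _ _ = _
        rw [R.pushS_of_mem hE hF' _ h, R.pushS_of_notMem hE hF' _ (R.lst_notMem e),
          Finset.sum_mul, Finset.sum_eq_single e]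
        · rw [mul_assoc, ← last, CKFamily.star_mul_self, R.rng_last, CKFamily.S_mul_P]
        · intro e' he' hne
          rw [mul_assoc, ← last, CKFamily.star_S_mul_S _ hE
            (R.last_ne hF' ((R.mem_fiber hE).1 he') hne), mul_zero]
        · exact fun h' => absurd ((R.mem_fiber hE).2 rfl) h'
      · rw [R.pullS_of_notMem _ h, hψS]
        change R.pushS hE hF' _ _ = _
        rw [R.pushS_of_notMem hE hF' _ h, R.lift_fst hF' h]
  · refine hom_eq_of_eq_on_generators _ _ (fun w => ?_) (fun f => ?_)
    · change φ (ψ _) = _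
      rw [hψP]
      change φ ((universalFamily E).P _) = _
      rw [hφP]
      change (universalFamily F).P _ = _
      rw [Equiv.apply_symm_apply]
      rfl
    · change φ (ψ _) = (universalFamily F).S f
      rw [hψS]
      change φ (R.pushS hE hF' _ f) = _
      by_cases h : f ∈ R.split
      · rw [R.pushS_of_mem hE hF' _ h, map_sum]
        have h1 : ∀ e ∈ R.fiber hE f, φ ((universalFamily E).S e *
            star ((universalFamily E).S (R.last hF' e))) =
            (universalFamily F).S f * ((universalFamily F).S (R.lst e) *
              star ((universalFamily F).S (R.lst e))) := fun e he => by
          have he' := (R.mem_fiber hE).1 he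
          rw [map_mul, map_star, hφS, hφS]
          change R.pullS _ _ * star (R.pullS _ _) = _
          rw [R.pullS_of_mem _ (he' ▸ h), he', R.pullS_of_notMem _
            (by rw [R.fst_last]; exact R.lst_notMem e), R.fst_last, mul_assoc]
        rw [Finset.sum_congr rfl h1, ← Finset.mul_sum]
        -- `sum_last` is applied to the pulled-back family, where `S (last e)` is the generator of
        -- `lst e`; the inner sum becomes the projection at the range of `f`.
        have h2 := R.sum_last hE hF' (R.pullFamily hF hF' (universalFamily F)) h
        have h3 : ∀ e, (R.pullFamily hF hF' (universalFamily F)).S (R.last hF' e)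
            = (universalFamily F).S (R.lst e) := fun e => by
          change R.pullS _ _ = _
          rw [R.pullS_of_notMem _ (by rw [R.fst_last]; exact R.lst_notMem e), R.fst_last]
        simp only [h3] at h2
        rw [h2]
        change _ * (universalFamily F).P _ = _
        rw [Equiv.apply_symm_apply, CKFamily.S_mul_P]
      · rw [R.pushS_of_notMem hE hF' _ h, hφS]
        change R.pullS _ _ = _
        rw [R.pullS_of_notMem _ (by rwa [R.fst_lift]), R.fst_lift]

end EdgeRecoding

/-! ### Primitive equivalence of graphs -/

namespace EdgeRecoding

variable {E F : DirectedGraph.{u}}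

theorem noSinks_of_noSinks (R : EdgeRecoding E F) (hE : E.NoSinks) : F.NoSinks := fun w => by
  obtain ⟨e, he⟩ := hE (R.vertexEquiv.symm w)
  exact ⟨R.fst e, by rw [R.src_fst, he, Equiv.apply_symm_apply]⟩

/-- Without sinks every edge of `F`, split or not, starts some block, so the edges at a vertex of
`F` are images of those at the corresponding vertex of `E`. -/
theorem rowFinite_of_rowFinite (R : EdgeRecoding E F) (hE : E.RowFinite) (hE' : E.NoSinks) :
    F.RowFinite := fun w => by
  refine ((hE (R.vertexEquiv.symm w)).image R.fst).subset fun f hf => ?_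
  obtain ⟨e, rfl⟩ := R.fst_surjective (R.noSinks_of_noSinks hE') f
  have hf : F.src (R.fst e) = w := hf
  exact ⟨e, by rw [← hf, R.src_fst, Equiv.symm_apply_apply]; rfl, rfl⟩

/-- The recoding given by an isomorphism of graphs without multiple edges. -/
theorem nonempty_of_equiv (hE : E.NoMultipleEdges) (hF : F.NoMultipleEdges)
    (σ : E.Vertex ≃ F.Vertex)
    (h : ∀ v w, (∃ e, E.src e = v ∧ E.rng e = w) ↔ ∃ f, F.src f = σ v ∧ F.rng f = σ w) :
    Nonempty (EdgeRecoding E F) := by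
  choose τ hτ using fun e => (h (E.src e) (E.rng e)).1 ⟨e, rfl, rfl⟩
  exact ⟨{
    vertexEquiv := σ
    split := ∅
    fst := τ
    lst := τ
    src_fst := fun e => (hτ e).1
    rng_lst := fun e => (hτ e).2
    notMem_of_consecutive := fun d hd => hd.elim
    lst_eq := fun e _ => rfl
    consecutive := fun e he => he.elim
    edge_ext := fun e e' he _ => hE e e'
      (σ.injective (by rw [← (hτ e).1, he, (hτ e').1]))
      (σ.injective (by rw [← (hτ e).2, he, (hτ e').2]))
    exists_single := fun f _ => by
      obtain ⟨e, he1, he2⟩ := (h (σ.symm (F.src f)) (σ.symm (F.rng f))).2 ⟨f, by simp, by simp⟩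
      exact ⟨e, hF _ _ (by rw [(hτ e).1, he1, σ.apply_symm_apply])
        (by rw [(hτ e).2, he2, σ.apply_symm_apply])⟩
    exists_pair := fun d hd => hd.elim }⟩

end EdgeRecoding

/-! ### Primitive transfers as recodings -/

/-- The graph, without multiple edges, whose edges are the entries `1` of a matrix. -/
def ofMatrix {V : Type u} (B : Matrix V V ℕ) : DirectedGraph.{u} where
  Vertex := V
  Edge := {q : V × V // B q.1 q.2 = 1}
  src e := e.1.1
  rng e := e.1.2

theorem ofMatrix_noMultipleEdges {V : Type u} (B : Matrix V V ℕ) :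
    (ofMatrix B).NoMultipleEdges :=
  fun _ _ h h' => Subtype.ext (Prod.ext h h')

theorem exists_edge_ofMatrix {V : Type u} (B : Matrix V V ℕ) (i j : V) :
    (∃ e, (ofMatrix B).src e = i ∧ (ofMatrix B).rng e = j) ↔ B i j = 1 := by
  constructor
  · rintro ⟨e, rfl, rfl⟩
    exact e.2
  · exact fun h => ⟨⟨(i, j), h⟩, rfl, rfl⟩

theorem exists_edge_iff {E : DirectedGraph.{u}} (hE : E.NoMultipleEdges) (v w : E.Vertex) :
    (∃ e, E.src e = v ∧ E.rng e = w) ↔ E.vertexMatrix v w = 1 := by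
  rw [vertexMatrix, Set.ncard_eq_one]
  constructor
  · rintro ⟨e, rfl, rfl⟩
    exact ⟨e, Set.eq_singleton_iff_unique_mem.2 ⟨⟨rfl, rfl⟩, fun f hf => hE f e hf.1 hf.2⟩⟩
  · rintro ⟨e, he⟩
    have : e ∈ {e | E.src e = v ∧ E.rng e = w} := he ▸ Set.mem_singleton e
    exact ⟨e, this⟩

open Classical in
-- Since `B p j ≤ 1`, the row equation makes `K` and the supports of the rows `B m` pairwise
-- disjoint. So `j ∉ K` with `B p j = 1` determines its intermediate vertex `mid j`.
theorem IsPrimitiveTransferAt.nonempty_recoding {V : Type u} {B C : Matrix V V ℕ} {p : V}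
    (h : IsPrimitiveTransferAt B C p) :
    Nonempty (EdgeRecoding (ofMatrix B) (ofMatrix C)) := by
  obtain ⟨h01, -, K, M, hKM, hpM, -, hrow, hC⟩ := h
  have hle : ∀ i j, B i j ≤ 1 := fun i j => by rcases h01 i j with h | h <;> omega
  have hrow' : ∀ j, B p j = (if j ∈ K then 1 else 0) + ∑ m ∈ M, B m j := fun j => by
    rw [hrow, Finset.sum_ite_eq]
  have hCp : ∀ j, C p j = 1 ↔ j ∈ K ∨ j ∈ M := fun j => by
    rw [hC, if_pos rfl]
    split_ifs with h <;> simp [h]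
  have hCi : ∀ i j, i ≠ p → C i j = B i j := fun i j hi => by rw [hC, if_neg hi]
  have hmp : ∀ m ∈ M, m ≠ p := fun m hm h => hpM (h ▸ hm)
  have hterm : ∀ m ∈ M, ∀ j, B m j ≤ ∑ m ∈ M, B m j := fun m hm j =>
    Finset.single_le_sum (f := fun m => B m j) (fun _ _ => Nat.zero_le _) hm
  have hBK : ∀ j ∈ K, B p j = 1 := fun j hj => by
    have h1 := hrow' j
    have h2 := hle p j
    rw [if_pos hj] at h1
    omega
  have hBM : ∀ m ∈ M, ∀ j, B m j = 1 → B p j = 1 ∧ j ∉ K := fun m hm j hj => by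
    have h1 := hrow' j
    have h2 := hle p j
    have h3 := hterm m hm j
    split_ifs at h1 with h4
    · omega
    · exact ⟨by omega, h4⟩
  have huniq : ∀ m ∈ M, ∀ m' ∈ M, ∀ j, B m j = 1 → B m' j = 1 → m = m' := by
    intro m hm m' hm' j hj hj'
    by_contra hne
    have h1 := hrow' j
    have h2 := hle p j
    have h3 := Finset.add_sum_erase M (fun m => B m j) hm
    have h4 : B m' j ≤ ∑ m ∈ M.erase m, B m j :=
      Finset.single_le_sum (f := fun m => B m j) (fun _ _ => Nat.zero_le _)
        (Finset.mem_erase.2 ⟨fun h => hne h.symm, hm'⟩)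
    omega
  have hex : ∀ j, ∃ m, B p j = 1 → j ∉ K → m ∈ M ∧ B m j = 1 := fun j => by
    by_cases hj : B p j = 1 ∧ j ∉ K
    · have h1 := hrow' j
      rw [if_neg hj.2, hj.1, zero_add] at h1
      obtain ⟨m, hm, hmj⟩ := Finset.exists_ne_zero_of_sum_ne_zero (h1 ▸ one_ne_zero)
      exact ⟨m, fun _ _ => ⟨hm, (h01 m j).resolve_left hmj⟩⟩
    -- A junk value that makes `mid` total.
    · exact ⟨j, fun h1 h2 => absurd ⟨h1, h2⟩ hj⟩
  choose mid hmid using hex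
  let fst : (ofMatrix B).Edge → (ofMatrix C).Edge := fun e =>
    if h : e.1.1 = p ∧ e.1.2 ∉ K then
      ⟨(p, mid e.1.2), (hCp _).2 (Or.inr (hmid _ (h.1 ▸ e.2) h.2).1)⟩
    else ⟨e.1, by
      by_cases hp : e.1.1 = p
      · have : e.1.2 ∈ K := by_contra fun hK => h ⟨hp, hK⟩
        rw [hp]
        exact (hCp _).2 (Or.inl this)
      · exact (hCi _ _ hp).trans e.2⟩
  let lst : (ofMatrix B).Edge → (ofMatrix C).Edge := fun e =>
    if h : e.1.1 = p ∧ e.1.2 ∉ K then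
      ⟨(mid e.1.2, e.1.2), by
        have h1 := hmid _ (h.1 ▸ e.2) h.2
        exact (hCi _ _ (hmp _ h1.1)).trans h1.2⟩
    else fst e
  have hfst : ∀ e, (e.1.1 = p ∧ e.1.2 ∉ K) → (fst e).1 = (p, mid e.1.2) := fun e h =>
    congrArg Subtype.val (dif_pos h)
  have hfst' : ∀ e, ¬(e.1.1 = p ∧ e.1.2 ∉ K) → (fst e).1 = e.1 := fun e h =>
    congrArg Subtype.val (dif_neg h)
  have hlst : ∀ e, (e.1.1 = p ∧ e.1.2 ∉ K) → (lst e).1 = (mid e.1.2, e.1.2) := fun e h =>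
    congrArg Subtype.val (dif_pos h)
  have hlst' : ∀ e, ¬(e.1.1 = p ∧ e.1.2 ∉ K) → lst e = fst e := fun e h =>
    dif_neg h
  -- Disjointness of `K` and `M` keeps the unchanged edges `p → k` from being split edges.
  have hsplit : ∀ e, ((fst e).1.1 = p ∧ (fst e).1.2 ∈ M) ↔ (e.1.1 = p ∧ e.1.2 ∉ K) := by
    intro e
    by_cases h : e.1.1 = p ∧ e.1.2 ∉ K
    · rw [hfst e h]
      exact iff_of_true ⟨rfl, (hmid _ (h.1 ▸ e.2) h.2).1⟩ h
    · rw [hfst' e h]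
      exact ⟨fun h' => ⟨h'.1, Finset.disjoint_right.1 hKM h'.2⟩, fun h' => absurd h' h⟩
  exact ⟨{
    vertexEquiv := Equiv.refl V
    split := {f | f.1.1 = p ∧ f.1.2 ∈ M}
    fst := fst
    lst := lst
    src_fst := fun e => by
      change (fst e).1.1 = e.1.1
      by_cases h : e.1.1 = p ∧ e.1.2 ∉ K
      · rw [hfst e h, h.1]
      · rw [hfst' e h]
    rng_lst := fun e => by
      change (lst e).1.2 = e.1.2
      by_cases h : e.1.1 = p ∧ e.1.2 ∉ K
      · rw [hlst e h]
      · rw [hlst' e h, hfst' e h]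
    notMem_of_consecutive := fun d hd f hdf hf => by
      have hdf : d.1.2 = f.1.1 := hdf
      exact hpM (hf.1 ▸ hdf ▸ hd.2)
    lst_eq := fun e he => hlst' e fun h => he ((hsplit e).2 h)
    consecutive := fun e he => by
      have h := (hsplit e).1 he
      change (fst e).1.2 = (lst e).1.1
      rw [hfst e h, hlst e h]
    edge_ext := fun e e' h1 h2 => by
      have h3 := (hsplit e).symm.trans ((by rw [h1]) : _ ↔ _) |>.trans (hsplit e')
      apply Subtype.ext
      by_cases h : e.1.1 = p ∧ e.1.2 ∉ K
      · have h' := h3.1 h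
        have h4 := congrArg (fun f => f.1.2) h2
        simp only [hlst e h, hlst e' h'] at h4
        exact Prod.ext (h.1.trans h'.1.symm) h4
      · rw [← hfst' e h, ← hfst' e' (fun h' => h (h3.2 h')), h1]
    exists_single := fun f hf => by
      have hfK : f.1.1 = p → f.1.2 ∈ K := fun hp => by
        have := f.2
        rw [hp, hCp] at this
        exact this.resolve_right fun hM => hf ⟨hp, hM⟩
      have hB : B f.1.1 f.1.2 = 1 := by
        by_cases hp : f.1.1 = p
        · rw [hp]
          exact hBK _ (hfK hp)
        · rw [← hCi _ _ hp]
          exact f.2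
      exact ⟨⟨f.1, hB⟩, Subtype.ext (hfst' _ fun h => h.2 (hfK h.1))⟩
    exists_pair := fun d hd f hdf => by
      have hdf : d.1.2 = f.1.1 := hdf
      have hm : f.1.1 ∈ M := hdf ▸ hd.2
      have hB : B f.1.1 f.1.2 = 1 := by
        rw [← hCi _ _ (hmp _ hm)]
        exact f.2
      have h1 := hBM _ hm _ hB
      have h2 := hmid _ h1.1 h1.2
      -- Uniqueness of the intermediate vertex identifies the block of `p → j` with the given pair.
      have h3 : mid f.1.2 = f.1.1 := huniq _ h2.1 _ hm _ h2.2 hB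
      let e : (ofMatrix B).Edge := ⟨(p, f.1.2), h1.1⟩
      have he : e.1.1 = p ∧ e.1.2 ∉ K := ⟨rfl, h1.2⟩
      refine ⟨e, Subtype.ext ?_, Subtype.ext ?_⟩
      · rw [hfst e he]
        exact Prod.ext hd.1.symm (h3.trans hdf.symm)
      · rw [hlst e he]
        exact Prod.ext h3 rfl }⟩

/-- The path groupoids and the graph algebras of two graphs are isomorphic. -/
def SameGroupoidAndAlgebra (E F : DirectedGraph.{u}) : Prop :=
  TopologicalGroupoidIso E.InfPath F.InfPath ∧
    Nonempty (E.GraphCStarAlgebra ≃⋆ₐ[ℂ] F.GraphCStarAlgebra)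

/-- If one of the graphs is row-finite without sinks, then so is the other, and their path groupoids
and graph algebras are isomorphic. -/
def RegularEquivalent (E F : DirectedGraph.{u}) : Prop :=
  (E.RowFinite ∧ E.NoSinks ↔ F.RowFinite ∧ F.NoSinks) ∧
    (E.RowFinite ∧ E.NoSinks → SameGroupoidAndAlgebra E F)

theorem RegularEquivalent.refl (E : DirectedGraph.{u}) : RegularEquivalent E E :=
  ⟨Iff.rfl, fun _ => ⟨.refl _, ⟨StarAlgEquiv.refl _ _⟩⟩⟩

theorem RegularEquivalent.symm {E F : DirectedGraph.{u}} (h : RegularEquivalent E F) :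
    RegularEquivalent F E :=
  ⟨h.1.symm, fun hF =>
    have h' := h.2 (h.1.2 hF)
    ⟨h'.1.symm, h'.2.map StarAlgEquiv.symm⟩⟩

theorem RegularEquivalent.trans {E F G : DirectedGraph.{u}} (h : RegularEquivalent E F)
    (h' : RegularEquivalent F G) : RegularEquivalent E G :=
  ⟨h.1.trans h'.1, fun hE =>
    have h1 := h.2 hE
    have h2 := h'.2 (h.1.1 hE)
    ⟨h1.1.trans h2.1, h1.2.elim fun φ => h2.2.map fun ψ => φ.trans ψ⟩⟩

theorem EdgeRecoding.regularEquivalent {E F : DirectedGraph.{u}} (R : EdgeRecoding E F) :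
    RegularEquivalent E F := by
  have h : F.RowFinite ∧ F.NoSinks → E.RowFinite ∧ E.NoSinks :=
    fun h => ⟨R.rowFinite h.1, R.noSinks h.2⟩
  have h' : E.RowFinite ∧ E.NoSinks → F.RowFinite ∧ F.NoSinks :=
    fun h => ⟨R.rowFinite_of_rowFinite h.1 h.2, R.noSinks_of_noSinks h.2⟩
  exact ⟨⟨h', h⟩, fun hE => ⟨R.topologicalGroupoidIso,
    R.nonempty_graphCStarAlgebra_equiv (h' hE).1 (h' hE).2⟩⟩

theorem PrimitiveStep.regularEquivalent {V : Type u} {B C : Matrix V V ℕ}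
    (h : PrimitiveStep B C) : RegularEquivalent (ofMatrix B) (ofMatrix C) := by
  rcases h with ⟨p, h⟩ | ⟨p, h⟩ | ⟨σ, h⟩
  · exact h.nonempty_recoding.elim fun R => R.regularEquivalent.symm
  · exact h.nonempty_recoding.elim fun R => R.regularEquivalent
  · refine (EdgeRecoding.nonempty_of_equiv (ofMatrix_noMultipleEdges B)
      (ofMatrix_noMultipleEdges C) σ fun i j => ?_).elim fun R => R.regularEquivalent
    exact (exists_edge_ofMatrix B i j).trans
      ((Eq.congr_left (h i j)).trans (exists_edge_ofMatrix C (σ i) (σ j)).symm)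

theorem regularEquivalent_of_reflTransGen {V : Type u} {B C : Matrix V V ℕ}
    (h : Relation.ReflTransGen PrimitiveStep B C) :
    RegularEquivalent (ofMatrix B) (ofMatrix C) := by
  induction h with
  | refl => exact .refl _
  | tail _ h ih => exact ih.trans h.regularEquivalent

theorem regularEquivalent_ofMatrix {E : DirectedGraph.{u}} (hE : E.NoMultipleEdges)
    {V : Type u} (σ : V ≃ E.Vertex) :
    RegularEquivalent (ofMatrix (E.vertexMatrix.submatrix σ σ)) E := by
  refine (EdgeRecoding.nonempty_of_equiv (ofMatrix_noMultipleEdges _) hE σ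
    fun i j => ?_).elim fun R => R.regularEquivalent
  exact (exists_edge_ofMatrix _ i j).trans (exists_edge_iff hE (σ i) (σ j)).symm

theorem PrimitivelyEquivalent.regularEquivalent {E F : DirectedGraph.{u}}
    (hE : E.NoMultipleEdges) (hF : F.NoMultipleEdges) (h : PrimitivelyEquivalent E F) :
    RegularEquivalent E F := by
  obtain ⟨σ, -, -, h⟩ := h
  exact (regularEquivalent_ofMatrix hE (Equiv.refl _)).symm.trans
    ((regularEquivalent_of_reflTransGen h).trans (regularEquivalent_ofMatrix hF σ))

end DirectedGraph

theorem mainTheorem3 (E F : DirectedGraph.{u})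
    (hE : E.NoMultipleEdges) (hF : F.NoMultipleEdges)
    (hrow : E.RowFinite) (hsinks : E.NoSinks)
    (hEF : DirectedGraph.PrimitivelyEquivalent E F) :
    DirectedGraph.TopologicalGroupoidIso E.InfPath F.InfPath ∧
      Nonempty (E.GraphCStarAlgebra ≃⋆ₐ[ℂ] F.GraphCStarAlgebra) :=
  (hEF.regularEquivalent hE hF).2 ⟨hrow, hsinks⟩
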